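/- Let $k$ be a field, $S=k[y_1,y_2,y_3]$ with the standard grading, $f=y_1^3+y_1^2y_3-y_2^2y_3$ and $R=S/(f)$. Let $V(f)\subset\mathbb P^2_k$ be the set of $k$-rational points of the curve $f=0$, $s=(0:0:1)$ and $V(f)_{\mathrm{reg}}=V(f)\setminus\{s\}$. For $\lambda=(\lambda_1:\lambda_2:1)\in V(f)$ put \[ \varphi_\lambda=\begin{pmatrix} y_1-\lambda_1y_3 & y_2y_3+\lambda_2y_3^2\\ y_2-\lambda_2y_3 & y_1^2+(\lambda_1+1)y_1y_3+(\lambda_1^2+\lambda_1)y_3^2\end{pmatrix},\quad \psi_\lambda=\begin{pmatrix} y_1^2+(\lambda_1+1)y_1y_3+(\lambda_1^2+\lambda_1)y_3^2 & -(y_2y_3+\lambda_2y_3^2)\\ -(y_2-\lambda_2y_3) & y_1-\lambda_1y_3\end{pmatrix}, \] and for $\lambda=(0:1:0)$ (the only other point of $V(f)$) put \[ \varphi_\lambda=\begin{pmatrix} y_1+y_3 & y_2^2\\ y_3 & y_1^2\end{pmatrix},\quad \psi_\lambda=\begin{pmatrix} y_1^2 & -y_2^2\\ -y_3 & y_1+y_3\end{pmatrix}.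 \] Regard them as graded maps $\varphi_\lambda:R(-2)\oplus R(-3)\to R(-1)^2$ and $\psi_\lambda:R(-2)^2\to R\oplus R(-1)$, so that $\operatorname{Coker}\varphi_\lambda$ and $\operatorname{Coker}\psi_\lambda$ are graded $R$-modules. Let $\mathcal M_{-1}=\{\operatorname{Coker}\varphi_\lambda\mid\lambda\in V(f)_{\mathrm{reg}}\}$, $\mathcal M_1=\{\operatorname{Coker}\psi_\lambda\mid\lambda\in V(f)_{\mathrm{reg}}\}$ and $\underline{\mathcal M}=\{\operatorname{Coker}\varphi_s,\operatorname{Coker}\psi_s\}$. A graded maximal Cohen--Macaulay (MCM) $R$-module is a finitely generated $\mathbb Z$-graded $R$-module whose depth with respect to $(y_1,y_2,y_3)$ equals $\dim R$. Then: 1. For every $\lambda\in V(f)$, $(\varphi_\lambda,\psi_\lambda)$ is a graded matrix factorization of $f$: $\varphi_\lambda\psi_\lambda=\psi_\lambda\varphi_\lambda=f\cdot\mathbf 1_2$ over $S$, with homogeneous entries of the degrees prescribed by the above graded maps. 2. Every non-free graded MCM $R$-module whose minimal number of generators is two is isomorphic, as a graded module up to a shift of the grading, to a module from $\mathcal M_{-1}\cup\mathcal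 M_1\cup\underline{\mathcal M}$. 3. The modules $\operatorname{Coker}\varphi_\lambda$ and $\operatorname{Coker}\psi_\lambda$, $\lambda\in V(f)$, are pairwise non-isomorphic, even as ungraded $R$-modules; hence the module in (2) is unique. 4. All modules from $\mathcal M_{-1}\cup\mathcal M_1\cup\underline{\mathcal M}$ have rank $1$. 5. For every $\lambda\in V(f)_{\mathrm{reg}}$, $(\operatorname{Coker}\psi_\lambda)(-2)$ is, as a graded module, isomorphic to the first syzygy module (the kernel of a minimal graded free cover) of $\operatorname{Coker}\varphi_\lambda$, and $\operatorname{Coker}\psi_\lambda$ is, as a graded module, isomorphic to the dual $\operatorname{Hom}_R(\operatorname{Coker}\varphi_\lambda,R)$. -/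

import Mathlib

open scoped LinearAlgebra.Projectivization

noncomputable section

namespace SimpleNode

universe u v w

section Ring

variable (k : Type u) [Field k]

/-- The polynomial ring `S = k[y₁, y₂, y₃]`; the variables are `X 0`, `X 1`, `X 2`. -/
abbrev PolyRing : Type u := MvPolynomial (Fin 3) k

/-- The cubic form `f = y₁³ + y₁² y₃ - y₂² y₃`. -/
def cubic : PolyRing k :=
  MvPolynomial.X 0 ^ 3 + MvPolynomial.X 0 ^ 2 * MvPolynomial.X 2
    - MvPolynomial.X 1 ^ 2 * MvPolynomial.X 2

/-- The homogeneous coordinate ring `R = S / (f)` (the affine cone of the simple node). -/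
abbrev NodeRing : Type u := PolyRing k ⧸ Ideal.span {cubic k}

/-- Homogeneous polynomials of integer degree `d` (only `0` if `d < 0`). -/
def polyDeg (d : ℤ) : Submodule k (PolyRing k) :=
  if 0 ≤ d then MvPolynomial.homogeneousSubmodule (Fin 3) k d.toNat else ⊥

/-- The degree `d` component `R_d` of `R`. -/
def ringDeg (d : ℤ) : AddSubgroup (NodeRing k) :=
  (polyDeg k d).toAddSubgroup.map (Ideal.Quotient.mk (Ideal.span {cubic k})).toAddMonoidHom

/-- The irrelevant ideal `𝔪 = (y₁, y₂, y₃)` of `R`. -/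
def irrelevant : Ideal (NodeRing k) :=
  Ideal.span (Set.range fun i : Fin 3 =>
    Ideal.Quotient.mk (Ideal.span {cubic k}) (MvPolynomial.X i))

end Ring

section GradedModules

variable {k : Type u} [Field k]
variable {M : Type v} [AddCommGroup M] [Module (NodeRing k) M]
variable {N : Type w} [AddCommGroup N] [Module (NodeRing k) N]

/-- The family `gr` makes the `R`-module `M` a `ℤ`-graded `R`-module. -/
structure IsGrading (gr : ℤ → AddSubgroup M) : Prop where
  isInternal : DirectSum.IsInternal gr
  smul_mem : ∀ (i j : ℤ) (r : NodeRing k) (m : M),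
    r ∈ ringDeg k i → m ∈ gr j → r • m ∈ gr (i + j)

/-- Graded maximal Cohen-Macaulay `R`-modules: finitely generated graded modules whose depth
with respect to the irrelevant ideal equals the Krull dimension of `R`. -/
structure IsGradedMCM (gr : ℤ → AddSubgroup M) : Prop where
  isGrading : IsGrading (k := k) gr
  finite : Module.Finite (NodeRing k) M
  exists_regular : ∃ rs : List (NodeRing k),
    (∀ r ∈ rs, r ∈ irrelevant k) ∧ RingTheory.Sequence.IsRegular M rs ∧
      (rs.length : WithBot ℕ∞) = ringKrullDim (NodeRing k)

/-- There is an `R`-linear isomorphism `M ≃ N`, homogeneous of degree `d`. -/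
def GradedIso (k : Type u) [Field k] {M : Type v} [AddCommGroup M] [Module (NodeRing k) M]
    {N : Type w} [AddCommGroup N] [Module (NodeRing k) N]
    (grM : ℤ → AddSubgroup M) (grN : ℤ → AddSubgroup N) (d : ℤ) : Prop :=
  ∃ e : M ≃ₗ[NodeRing k] N, ∀ j : ℤ, (grM j).map (e : M →+ N) = grN (j + d)

/-- The grading of the free module `⨁ᵢ R(-aᵢ)`: the `i`-th basis vector has degree `aᵢ`. -/
def freeDeg (k : Type u) [Field k] {n : ℕ} (a : Fin n → ℤ) (j : ℤ) :
    AddSubgroup (Fin n → NodeRing k) :=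
  AddSubgroup.pi Set.univ fun i => ringDeg k (j - a i)

/-- The grading of the dual `Hom_R(M, R)`: its degree `j` component consists of the linear forms
which are homogeneous of degree `j`. -/
def dualDeg (k : Type u) [Field k] {M : Type v} [AddCommGroup M] [Module (NodeRing k) M]
    (gr : ℤ → AddSubgroup M) (j : ℤ) : AddSubgroup (Module.Dual (NodeRing k) M) where
  carrier := {g | ∀ i : ℤ, ∀ m ∈ gr i, g m ∈ ringDeg k (i + j)}
  zero_mem' := fun _ _ _ => zero_mem _
  add_mem' := fun hg hh i m hm => add_mem (hg i m hm) (hh i m hm)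
  neg_mem' := fun hg i m hm => neg_mem (hg i m hm)

/-- `N`, shifted so that its degree `j` component is placed in degree `j + d`, is the first syzygy
module of `M`: it is isomorphic to the kernel of a minimal graded free cover of `M`. -/
def IsFirstSyzygy (k : Type u) [Field k] {N : Type w} [AddCommGroup N] [Module (NodeRing k) N]
    {M : Type v} [AddCommGroup M] [Module (NodeRing k) M]
    (grN : ℤ → AddSubgroup N) (grM : ℤ → AddSubgroup M) (d : ℤ) : Prop :=
  ∃ (n : ℕ) (a : Fin n → ℤ) (p : (Fin n → NodeRing k) →ₗ[NodeRing k] M),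
    Function.Surjective p ∧
    (∀ (j : ℤ) (x : Fin n → NodeRing k), x ∈ freeDeg k a j → p x ∈ grM j) ∧
    LinearMap.ker p ≤ irrelevant k • (⊤ : Submodule (NodeRing k) (Fin n → NodeRing k)) ∧
    GradedIso k grN
      (fun j => (freeDeg k a j).comap (LinearMap.ker p).subtype.toAddMonoidHom) d

end GradedModules

section MatrixFactorizations

/-- `(A, B)` is a graded matrix factorization of the form `g` of degree `e`:
`A B = B A = g · 1`, where `A : ⨁ S(-bⱼ) → ⨁ S(-aᵢ)` and `B : ⨁ S(-aⱼ - e) → ⨁ S(-bᵢ)`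
are homogeneous of degree `0`. -/
structure IsGradedMatrixFactorization {k : Type u} [Field k] {n : ℕ} (g : PolyRing k) (e : ℤ)
    (a b : Fin n → ℤ) (A B : Matrix (Fin n) (Fin n) (PolyRing k)) : Prop where
  mul_eq : A * B = g • (1 : Matrix (Fin n) (Fin n) (PolyRing k))
  mul_eq' : B * A = g • (1 : Matrix (Fin n) (Fin n) (PolyRing k))
  left_mem : ∀ i j, A i j ∈ polyDeg k (b j - a i)
  right_mem : ∀ i j, B i j ∈ polyDeg k (a j + e - b i)

/-- The `R`-linear map `Rⁿ → Rⁿ` given by a matrix over `S`. -/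
def matMap {k : Type u} [Field k] {n : ℕ} (A : Matrix (Fin n) (Fin n) (PolyRing k)) :
    (Fin n → NodeRing k) →ₗ[NodeRing k] (Fin n → NodeRing k) :=
  (A.map (Ideal.Quotient.mk (Ideal.span {cubic k}))).mulVecLin

/-- The `R`-module `Coker A`. -/
abbrev Coker {k : Type u} [Field k] {n : ℕ} (A : Matrix (Fin n) (Fin n) (PolyRing k)) : Type u :=
  (Fin n → NodeRing k) ⧸ LinearMap.range (matMap A)

/-- The grading of `Coker A` as a quotient of `⨁ᵢ R(-aᵢ)`. -/
def cokerDeg {k : Type u} [Field k] {n : ℕ} (A : Matrix (Fin n) (Fin n) (PolyRing k))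
    (a : Fin n → ℤ) (j : ℤ) : AddSubgroup (Coker A) :=
  (freeDeg k a j).map (LinearMap.range (matMap A)).mkQ.toAddMonoidHom

end MatrixFactorizations

section Curve

variable (k : Type u) [Field k]

/-- The set `V(f)` of `k`-rational points of the projective plane curve `f = 0`. -/
def curve : Set (ℙ k (Fin 3 → k)) := {p | MvPolynomial.eval p.rep (cubic k) = 0}

/-- The singular point `s = (0 : 0 : 1)`. -/
def singularPt : ℙ k (Fin 3 → k) :=
  Projectivization.mk k ![0, 0, 1] (fun h => one_ne_zero (congrFun h 2))

/-- The set `V(f)_reg = V(f) \ {s}`. -/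
def curveReg : Set (ℙ k (Fin 3 → k)) := curve k \ {singularPt k}

end Curve

section Matrices

open MvPolynomial

variable {k : Type u} [Field k]

/-- The matrix `φ_λ` for `λ = (a : b : 1)`. -/
def phiAff (a b : k) : Matrix (Fin 2) (Fin 2) (PolyRing k) :=
  !![X 0 - C a * X 2, X 1 * X 2 + C b * X 2 ^ 2;
     X 1 - C b * X 2, X 0 ^ 2 + C (a + 1) * X 0 * X 2 + C (a ^ 2 + a) * X 2 ^ 2]

/-- The matrix `ψ_λ` for `λ = (a : b : 1)`. -/
def psiAff (a b : k) : Matrix (Fin 2) (Fin 2) (PolyRing k) :=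
  !![X 0 ^ 2 + C (a + 1) * X 0 * X 2 + C (a ^ 2 + a) * X 2 ^ 2, -(X 1 * X 2 + C b * X 2 ^ 2);
     -(X 1 - C b * X 2), X 0 - C a * X 2]

variable (k) in
/-- The matrix `φ_λ` for `λ = (0 : 1 : 0)`. -/
def phiInf : Matrix (Fin 2) (Fin 2) (PolyRing k) :=
  !![X 0 + X 2, X 1 ^ 2;
     X 2, X 0 ^ 2]

variable (k) in
/-- The matrix `ψ_λ` for `λ = (0 : 1 : 0)`. -/
def psiInf : Matrix (Fin 2) (Fin 2) (PolyRing k) :=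
  !![X 0 ^ 2, -X 1 ^ 2;
     -X 2, X 0 + X 2]

open Classical in
/-- The matrix `φ_p`. A point with nonzero third coordinate is written as `(a : b : 1)`;
the only point of `V(f)` with vanishing third coordinate is `(0 : 1 : 0)`. -/
def phi (p : ℙ k (Fin 3 → k)) : Matrix (Fin 2) (Fin 2) (PolyRing k) :=
  if p.rep 2 = 0 then phiInf k else phiAff (p.rep 0 / p.rep 2) (p.rep 1 / p.rep 2)

open Classical in
/-- The matrix `ψ_p`, with the same conventions as for `φ_p`. -/
def psi (p : ℙ k (Fin 3 → k)) : Matrix (Fin 2) (Fin 2) (PolyRing k) :=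
  if p.rep 2 = 0 then psiInf k else psiAff (p.rep 0 / p.rep 2) (p.rep 1 / p.rep 2)

/-- The grading of `Coker φ_p`, where `φ_p : R(-2) ⊕ R(-3) → R(-1)²`. -/
def cokerPhiDeg (p : ℙ k (Fin 3 → k)) : ℤ → AddSubgroup (Coker (phi p)) :=
  cokerDeg (phi p) ![1, 1]

/-- The grading of `Coker ψ_p`, where `ψ_p : R(-2)² → R ⊕ R(-1)`. -/
def cokerPsiDeg (p : ℙ k (Fin 3 → k)) : ℤ → AddSubgroup (Coker (psi p)) :=
  cokerDeg (psi p) ![0, 1]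

end Matrices

end SimpleNode

end

/-!
A non-free graded MCM module with two generators over `R = S/(f)` has depth two, so by exactness of
the Koszul complexes its relations over `S` form a free module: it has a square homogeneous
presentation matrix over `S`, of determinant a unit times `f`. The degrees of the entries force, up
to exchanging the matrix with its adjugate, a column of two independent linear forms. These forms
vanish at a single point `p`, which lies on the curve because the determinant vanishes there, and
row and column operations bring the matrix to `phi p`, or to its adjugate `psi p`. Conversely, the
linear parts of a presentation matrix are determined by its cokernel up to equivalence over `k`, and
those of `phi p` and `psi p` recover `p` and tell the two apart.
-/

noncomputable section

namespace SimpleNode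

universe u v w

open MvPolynomial
open scoped Matrix

local notation "π" => Ideal.Quotient.mk (Ideal.span {cubic _})

section IntegerDegrees

variable {k : Type u} [Field k]

/-- The homogeneous component of integer degree `d` of a polynomial, zero if `d < 0`. -/
def homogComp (d : ℤ) : PolyRing k →ₗ[k] PolyRing k :=
  if 0 ≤ d then homogeneousComponent d.toNat else 0

lemma homogComp_natCast (n : ℕ) : homogComp (k := k) n = homogeneousComponent n := by
  simp [homogComp]

lemma homogComp_of_neg {d : ℤ} (hd : d < 0) : homogComp (k := k) d = 0 := by
  simp [homogComp, hd.not_ge]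

lemma mem_polyDeg_natCast {n : ℕ} {s : PolyRing k} : s ∈ polyDeg k n ↔ s.IsHomogeneous n := by
  simp [polyDeg]

lemma mem_polyDeg_of_neg {d : ℤ} (hd : d < 0) {s : PolyRing k} : s ∈ polyDeg k d ↔ s = 0 := by
  simp [polyDeg, hd.not_ge]

lemma homogComp_mem (d : ℤ) (s : PolyRing k) : homogComp d s ∈ polyDeg k d := by
  rcases lt_or_ge d 0 with hd | hd
  · simp [homogComp_of_neg hd]
  · lift d to ℕ using hd
    rw [homogComp_natCast, mem_polyDeg_natCast]
    exact homogeneousComponent_isHomogeneous _ _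

lemma homogComp_of_mem {d : ℤ} {s : PolyRing k} (hs : s ∈ polyDeg k d) (e : ℤ) :
    homogComp e s = if e = d then s else 0 := by
  rcases lt_or_ge d 0 with hd | hd
  · simp [(mem_polyDeg_of_neg hd).1 hs]
  lift d to ℕ using hd
  rcases lt_or_ge e 0 with he | he
  · rw [homogComp_of_neg he, if_neg (by lia), LinearMap.zero_apply]
  · lift e to ℕ using he
    rw [homogComp_natCast, homogeneousComponent_of_mem (mem_polyDeg_natCast.1 hs)]
    simp

lemma homogComp_self {d : ℤ} {s : PolyRing k} (hs : s ∈ polyDeg k d) : homogComp d s = s := by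
  simp [homogComp_of_mem hs]

lemma homogComp_eq_zero {d e : ℤ} {s : PolyRing k} (hs : s ∈ polyDeg k d) (h : e ≠ d) :
    homogComp e s = 0 := by
  simp [homogComp_of_mem hs, h]

lemma homogComp_zero (s : PolyRing k) : homogComp 0 s = C (constantCoeff s) := by
  simpa [constantCoeff_eq] using LinearMap.congr_fun (homogComp_natCast (k := k) 0) s

lemma exists_sum_homogComp (s : PolyRing k) :
    ∃ t : Finset ℤ, ∀ t', t ⊆ t' → ∑ d ∈ t', homogComp d s = s := by
  refine ⟨(Finset.range (s.totalDegree + 1)).map Nat.castEmbedding, fun t' ht => ?_⟩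
  rw [← Finset.sum_subset ht]
  · simp [homogComp_natCast, sum_homogeneousComponent]
  · intro d _ hd
    rcases lt_or_ge d 0 with h | h
    · simp [homogComp_of_neg h]
    · lift d to ℕ using h
      rw [homogComp_natCast]
      apply homogeneousComponent_eq_zero
      simpa using hd

lemma mul_mem_polyDeg {d e : ℤ} {s t : PolyRing k} (hs : s ∈ polyDeg k d)
    (ht : t ∈ polyDeg k e) : s * t ∈ polyDeg k (d + e) := by
  rcases lt_or_ge d 0 with hd | hd
  · simp [(mem_polyDeg_of_neg hd).1 hs]
  rcases lt_or_ge e 0 with he | he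
  · simp [(mem_polyDeg_of_neg he).1 ht]
  lift d to ℕ using hd
  lift e to ℕ using he
  exact_mod_cast mem_polyDeg_natCast.2
    ((mem_polyDeg_natCast.1 hs).mul (mem_polyDeg_natCast.1 ht))

lemma homogComp_mul {d : ℤ} {t : PolyRing k} (ht : t ∈ polyDeg k d) (e : ℤ) (s : PolyRing k) :
    homogComp e (s * t) = homogComp (e - d) s * t := by
  obtain ⟨u, hu⟩ := exists_sum_homogComp s
  rw [← hu u subset_rfl, Finset.sum_mul, map_sum, map_sum, Finset.sum_mul]
  refine Finset.sum_congr rfl fun i _ => ?_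
  rw [homogComp_of_mem (mul_mem_polyDeg (homogComp_mem i s) ht),
    homogComp_of_mem (homogComp_mem i s)]
  by_cases h : e - d = i
  · rw [if_pos h, if_pos (by lia)]
  · rw [if_neg h, if_neg (by lia), zero_mul]

lemma constantCoeff_eq_zero_of_mem {d : ℤ} (hd : d ≠ 0) {s : PolyRing k}
    (hs : s ∈ polyDeg k d) : constantCoeff s = 0 := by
  simpa [homogComp_zero] using homogComp_eq_zero hs hd.symm

lemma degree_pos_of_mem {d : ℤ} {s : PolyRing k} (hs : s ∈ polyDeg k d) (hs0 : s ≠ 0)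
    (hc : constantCoeff s = 0) : 0 < d := by
  by_contra! hd
  rcases hd.lt_or_eq with hd | rfl
  · exact hs0 ((mem_polyDeg_of_neg hd).1 hs)
  · exact hs0 (by rw [← homogComp_self hs, homogComp_zero, hc, C_0])

lemma degree_eq_of_mem {d e : ℤ} {s : PolyRing k} (hd : s ∈ polyDeg k d) (he : s ∈ polyDeg k e)
    (hs : s ≠ 0) : d = e := by
  by_contra h
  exact hs (by rw [← homogComp_self hd, homogComp_eq_zero he h])

lemma C_mem_polyDeg (c : k) : (C c : PolyRing k) ∈ polyDeg k 0 :=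
  mem_polyDeg_natCast.2 (isHomogeneous_C _ _)

lemma X_mem_polyDeg (i : Fin 3) : (X i : PolyRing k) ∈ polyDeg k 1 :=
  mem_polyDeg_natCast.2 (isHomogeneous_X _ _)

lemma C_mul_mem_polyDeg {d : ℤ} {s : PolyRing k} (c : k) (hs : s ∈ polyDeg k d) :
    C c * s ∈ polyDeg k d := by
  simpa using mul_mem_polyDeg (C_mem_polyDeg c) hs

lemma X_mul_X_mem_polyDeg (i j : Fin 3) : (X i * X j : PolyRing k) ∈ polyDeg k 2 :=
  mul_mem_polyDeg (X_mem_polyDeg i) (X_mem_polyDeg j)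

lemma X_sq_mem_polyDeg (i : Fin 3) : (X i ^ 2 : PolyRing k) ∈ polyDeg k 2 :=
  sq (X i : PolyRing k) ▸ X_mul_X_mem_polyDeg i i

lemma exists_linear_of_mem_polyDeg_one {l : PolyRing k} (hl : l ∈ polyDeg k 1) :
    ∃ c : Fin 3 → k, l = ∑ i, C (c i) * X i := by
  have hspan : l ∈ homogeneousSubmodule (Fin 3) k 1 := mem_polyDeg_natCast.1 hl
  rw [homogeneousSubmodule_one_eq_span_X, Submodule.mem_span_range_iff_exists_fun] at hspan
  obtain ⟨c, rfl⟩ := hspan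
  exact ⟨c, by simp only [smul_eq_C_mul]⟩

end IntegerDegrees

section Cubic

variable (k : Type u) [Field k]

lemma cubic_mem_polyDeg : cubic k ∈ polyDeg k 3 :=
  sub_mem (add_mem (mem_polyDeg_natCast.2 (isHomogeneous_X_pow 0 3))
    (mul_mem_polyDeg (X_sq_mem_polyDeg 0) (X_mem_polyDeg 2)))
    (mul_mem_polyDeg (X_sq_mem_polyDeg 1) (X_mem_polyDeg 2))

lemma cubic_irreducible : Irreducible (cubic k) := by
  have hlinear : cubic k = (X 0 ^ 2 - X 1 ^ 2) * X 2 + X 0 ^ 3 := by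
    rw [cubic]; ring
  have hndvd : ¬ (X 0 : PolyRing k) ∣ X 0 ^ 2 - X 1 ^ 2 := by
    rw [dvd_sub_right (dvd_pow_self _ two_ne_zero), (X_prime (i := 0)).dvd_pow_iff_dvd two_ne_zero,
      X_dvd_X]
    simp
  have hvars : (2 : Fin 3) ∉ (X 0 ^ 2 - X 1 ^ 2 : PolyRing k).vars := fun h => by
    rcases Finset.mem_union.1 (vars_sub_subset _ h) with h | h <;>
      simpa using vars_pow _ _ h
  rw [hlinear]
  refine irreducible_mul_X_add _ _ _ (fun h => hndvd (h ▸ dvd_zero _)) hvars ?_ ?_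
  · exact fun h => by simpa using vars_pow _ _ h
  · exact ((X_prime.irreducible.isRelPrime_iff_not_dvd.2 hndvd).symm).pow_right

lemma cubic_prime : Prime (cubic k) := (cubic_irreducible k).prime

lemma cubic_ne_zero : cubic k ≠ 0 := (cubic_prime k).ne_zero

instance : (Ideal.span {cubic k}).IsPrime :=
  (Ideal.span_singleton_prime (cubic_ne_zero k)).2 (cubic_prime k)

variable {k} in
lemma mk_eq_zero_iff {s : PolyRing k} :
    Ideal.Quotient.mk (Ideal.span {cubic k}) s = 0 ↔ cubic k ∣ s := by
  rw [Ideal.Quotient.eq_zero_iff_mem, Ideal.mem_span_singleton]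

lemma two_le_ringKrullDim : 2 ≤ ringKrullDim (NodeRing k) := by
  let line : PolyRing k →ₐ[k] Polynomial k := aeval ![0, Polynomial.X, 0]
  have hline : Function.Surjective line := by
    rw [← AlgHom.range_eq_top, ← Algebra.adjoin_range_eq_range_aeval, eq_top_iff,
      ← Polynomial.adjoin_X]
    exact Algebra.adjoin_mono (Set.singleton_subset_iff.2 ⟨1, rfl⟩)
  have hcubic : ∀ s ∈ Ideal.span {cubic k}, line s = 0 := fun s hs => by
    obtain ⟨t, rfl⟩ := Ideal.mem_span_singleton.1 hs
    simp [line, cubic]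
  have hX : Ideal.Quotient.mk (Ideal.span {cubic k}) (X 0) ∈ nonZeroDivisors (NodeRing k) := by
    rw [mem_nonZeroDivisors_iff_ne_zero, Ne, mk_eq_zero_iff]
    rintro ⟨t, ht⟩
    have heval := congrArg (eval ![-1, 0, 1]) ht
    simp [cubic, Odd.neg_one_pow (n := 3) (by decide)] at heval
  have hdim := ringKrullDim_succ_le_of_surjective (Ideal.Quotient.lift _ line.toRingHom hcubic)
    (Ideal.Quotient.lift_surjective_of_surjective _ _ hline) hX (by simp [line])
  rwa [IsPrincipalIdealRing.ringKrullDim_eq_one _ (Polynomial.not_isField k),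
    one_add_one_eq_two] at hdim

end Cubic

section Koszul

variable {A : Type u} [CommRing A] {N : Type v} [AddCommGroup N] [Module A N]

/-- The differential `w ↦ x × w` in the middle of the Koszul complex
`0 ⟶ N ⟶ N³ ⟶ N³ ⟶ N ⟶ 0` of three elements `x` on `N`. -/
def cross (x : Fin 3 → A) (w : Fin 3 → N) : Fin 3 → N :=
  ![x 1 • w 2 - x 2 • w 1, x 2 • w 0 - x 0 • w 2, x 0 • w 1 - x 1 • w 0]

/-- The Koszul complex of `x` on `N` is exact at the term mapped to `N` by `h ↦ ∑ i, x i • h i`. -/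
def KoszulExactOne (x : Fin 3 → A) (N : Type v) [AddCommGroup N] [Module A N] : Prop :=
  ∀ h : Fin 3 → N, ∑ i, x i • h i = 0 → ∃ w, h = cross x w

/-- The Koszul complex of `x` on `N` is exact at the term receiving `N` by `n ↦ (x i • n)ᵢ`. -/
def KoszulExactTwo (x : Fin 3 → A) (N : Type v) [AddCommGroup N] [Module A N] : Prop :=
  ∀ w : Fin 3 → N, cross x w = 0 → ∃ n, ∀ i, w i = x i • n

variable {x : Fin 3 → A}

lemma cross_eq_zero_iff {w : Fin 3 → N} : cross x w = 0 ↔ ∀ i j, x i • w j = x j • w i := by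
  refine ⟨fun h => ?_, fun h => ?_⟩
  · have h₀ : x 1 • w 2 - x 2 • w 1 = 0 := congrFun h 0
    have h₁ : x 2 • w 0 - x 0 • w 2 = 0 := congrFun h 1
    have h₂ : x 0 • w 1 - x 1 • w 0 = 0 := congrFun h 2
    rw [sub_eq_zero] at h₀ h₁ h₂
    intro i j
    fin_cases i <;> fin_cases j <;> first | rfl | assumption | (symm; assumption)
  · ext i
    fin_cases i <;> exact sub_eq_zero.2 (h _ _)

lemma map_cross {M : Type w} [AddCommGroup M] [Module A M] (T : N →ₗ[A] M) (w : Fin 3 → N)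
    (i : Fin 3) : T (cross x w i) = cross x (fun j => T (w j)) i := by
  fin_cases i <;> simp [cross]

lemma cross_sub_smul (w : Fin 3 → N) (n : N) : cross x (fun i => w i - x i • n) = cross x w := by
  ext i
  fin_cases i <;> simp only [cross, Fin.reduceFinMk, Matrix.cons_val] <;> module

lemma KoszulExactOne.pi {ι : Type w} (hN : KoszulExactOne x N) : KoszulExactOne x (ι → N) := by
  intro h hh
  choose w hw using fun l => hN (fun i => h i l) (by simpa using congrFun hh l)
  refine ⟨fun i l => w l i, ?_⟩
  ext i l
  exact (congrFun (hw l) i).trans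
    (map_cross (x := x) (LinearMap.proj (R := A) (φ := fun _ : ι => N) l) (fun j l => w l j) i).symm

lemma koszulExactOne_ker {M : Type w} [AddCommGroup M] [Module A M] {T : N →ₗ[A] M}
    (hT : Function.Surjective T) (hN : KoszulExactOne x N) (hM : KoszulExactTwo x M) :
    KoszulExactOne x (LinearMap.ker T) := by
  intro h hh
  obtain ⟨w, hw⟩ := hN (fun i => h i) (by simpa using congrArg (LinearMap.ker T).subtype hh)
  obtain ⟨m, hm⟩ := hM (fun i => T (w i)) (by
    ext i
    rw [← map_cross, ← hw, LinearMap.mem_ker.1 (h i).2, Pi.zero_apply])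
  obtain ⟨n, rfl⟩ := hT m
  let v : Fin 3 → LinearMap.ker T := fun i =>
    ⟨w i - x i • n, by rw [LinearMap.mem_ker, map_sub, map_smul, hm, sub_self]⟩
  refine ⟨v, funext fun i => Subtype.ext ?_⟩
  calc (h i : N) = cross x (fun j => w j - x j • n) i := by rw [cross_sub_smul, ← hw]
    _ = (cross x v i : LinearMap.ker T) := (map_cross (LinearMap.ker T).subtype v i).symm

open RingTheory.Sequence in
lemma koszulExactTwo_of_isWeaklyRegular {r s : A} (hr : r ∈ Ideal.span (Set.range x))
    (hs : s ∈ Ideal.span (Set.range x)) (hreg : IsWeaklyRegular N [r, s]) :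
    KoszulExactTwo x N := by
  intro w hw
  rw [cross_eq_zero_iff] at hw
  rw [Ideal.mem_span_range_iff_exists_fun] at hr hs
  obtain ⟨c, rfl⟩ := hr
  obtain ⟨d, rfl⟩ := hs
  obtain ⟨hr, hs, -⟩ := by simpa only [isWeaklyRegular_cons_iff] using hreg
  have hcomb (e : Fin 3 → A) (j : Fin 3) : x j • ∑ i, e i • w i = (∑ i, e i * x i) • w j := by
    simp only [Finset.smul_sum, Finset.sum_smul]
    exact Finset.sum_congr rfl fun i _ => by rw [smul_comm, hw j i, smul_smul]
  have hswap : (∑ i, c i * x i) • ∑ i, d i • w i = (∑ i, d i * x i) • ∑ i, c i • w i := by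
    rw [Finset.sum_smul, Finset.smul_sum]
    exact Finset.sum_congr rfl fun i _ => by rw [← smul_smul, hcomb, smul_comm]
  have hzero : (Submodule.Quotient.mk (∑ i, c i • w i) : QuotSMulTop (∑ i, c i * x i) N) = 0 := by
    refine hs.right_eq_zero_of_smul ?_
    rw [← Submodule.Quotient.mk_smul, ← hswap, Submodule.Quotient.mk_eq_zero]
    exact Submodule.smul_mem_pointwise_smul _ _ _ trivial
  rw [Submodule.Quotient.mk_eq_zero] at hzero
  obtain ⟨n, -, hn⟩ := (Submodule.mem_smul_pointwise_iff_exists _ _ _).1 hzero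
  refine ⟨n, fun i => hr ?_⟩
  change (∑ i, c i * x i) • w i = (∑ i, c i * x i) • x i • n
  rw [← hcomb, ← hn, smul_comm]

lemma linearIndependent_of_koszulExactOne [IsDomain A] [IsNoetherianRing A]
    (hx : Ideal.span (Set.range x) ≠ ⊤) (hN : KoszulExactOne x N) {ι : Type w} [Fintype ι]
    {g : ι → N} (hspan : Submodule.span A (Set.range g) = ⊤)
    (hrel : ∀ c : ι → A, ∑ i, c i • g i = 0 → ∀ i, c i ∈ Ideal.span (Set.range x)) :
    LinearIndependent A g := by
  let I := Ideal.span (Set.range x)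
  let T := Fintype.linearCombination A g
  have hT : Function.Surjective T := by
    rw [← LinearMap.range_eq_top, Fintype.range_linearCombination, hspan]
  have hker : LinearMap.ker T ≤ I • LinearMap.ker T := fun c hc => by
    choose e he using fun i => (Ideal.mem_span_range_iff_exists_fun).1 (hrel c hc i)
    have hce : c = ∑ j, x j • (fun i => e i j) := by
      ext i
      simp [← he, mul_comm]
    obtain ⟨w, hw⟩ := hN (fun j => T fun i => e i j) (by
      simp_rw [← map_smul, ← map_sum, ← hce]
      exact hc)
    choose v hv using fun j => hT (w j)
    have hsum : ∑ j, x j • cross x v j = 0 := by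
      simp only [Fin.sum_univ_three, cross, Matrix.cons_val]
      module
    rw [hce, ← sub_zero (∑ j, _), ← hsum, ← Finset.sum_sub_distrib]
    refine Submodule.sum_mem _ fun j _ => ?_
    rw [← smul_sub]
    refine Submodule.smul_mem_smul (Ideal.subset_span ⟨j, rfl⟩) ?_
    rw [LinearMap.mem_ker, map_sub, map_cross, sub_eq_zero]
    simp only [hv]
    exact congrFun hw j
  obtain ⟨r, hr1, hr⟩ := Submodule.exists_sub_one_mem_and_smul_eq_zero_of_fg_of_le_smul I
    (LinearMap.ker T) (IsNoetherian.noetherian _) hker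
  have hr0 : r ≠ 0 := by
    rintro rfl
    exact hx ((Ideal.eq_top_iff_one _).2 (by simpa using neg_mem hr1))
  exact Fintype.linearIndependent_iff.2 fun c hc i =>
    (mul_eq_zero.1 (congrFun (hr c hc) i)).resolve_left hr0

lemma koszulExactOne_X {R : Type u} [CommRing R] [IsDomain R] :
    KoszulExactOne (X : Fin 3 → MvPolynomial (Fin 3) R) (MvPolynomial (Fin 3) R) := by
  intro h hh
  simp only [Fin.sum_univ_three, smul_eq_mul] at hh
  have hmem : h 0 ∈ Ideal.span (X '' ({1, 2} : Set (Fin 3))) := by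
    have hX : X 0 * h 0 ∈ Ideal.span (X '' ({1, 2} : Set (Fin 3))) := by
      rw [Set.image_pair, Ideal.mem_span_pair]
      exact ⟨-h 1, -h 2, by linear_combination -hh⟩
    rw [mem_ideal_span_X_image] at hX ⊢
    intro m hm
    obtain ⟨i, hi, hne⟩ := hX (Finsupp.single 0 1 + m) (by
      rwa [mem_support_iff, coeff_X_mul, ← mem_support_iff])
    refine ⟨i, hi, ?_⟩
    rcases hi with rfl | rfl <;> simpa using hne
  rw [Set.image_pair, Ideal.mem_span_pair] at hmem
  obtain ⟨p, q, hpq⟩ := hmem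
  obtain ⟨t, ht⟩ : (X 1 : MvPolynomial (Fin 3) R) ∣ h 2 + X 0 * q := by
    have hdvd : X 1 ∣ X 2 * (h 2 + X 0 * q) :=
      ⟨-(h 1 + X 0 * p), by linear_combination hh + X 0 * hpq⟩
    exact (X_prime.dvd_or_dvd hdvd).resolve_left (by simp [X_dvd_X])
  have hone : h 1 + X 0 * p = -(X 2 * t) :=
    mul_left_cancel₀ (X_ne_zero (1 : Fin 3)) (by linear_combination hh - X 2 * ht + X 0 * hpq)
  refine ⟨![-t, -q, p], ?_⟩
  ext1 i
  fin_cases i <;> simp only [cross, Fin.reduceFinMk, Matrix.cons_val, smul_eq_mul]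
  · linear_combination -hpq
  · linear_combination hone
  · linear_combination ht

end Koszul

section MinimalGenerators

section

variable {A : Type u} [CommRing A] {M : Type v} [AddCommGroup M] [Module A M]

lemma exists_surjective_semilinearMap_quotient {I : Ideal A} {ι : Type w} [Fintype ι] {g : ι → M}
    (hspan : Submodule.span A (Set.range g) = ⊤)
    (hrel : ∀ c : ι → A, ∑ i, c i • g i = 0 → ∀ i, c i ∈ I) :
    ∃ φ : M →ₛₗ[Ideal.Quotient.mk I] (ι → A ⧸ I), Function.Surjective φ := by
  let T := Fintype.linearCombination A g
  have hT : Function.Surjective T := by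
    rw [← LinearMap.range_eq_top, Fintype.range_linearCombination, hspan]
  let reduction : (ι → A) →ₛₗ[Ideal.Quotient.mk I] (ι → A ⧸ I) :=
    { toFun := fun c i => Ideal.Quotient.mk I (c i)
      map_add' := fun _ _ => rfl
      map_smul' := fun _ _ => rfl }
  have hker : LinearMap.ker T ≤ LinearMap.ker reduction := fun c hc =>
    funext fun i => Ideal.Quotient.eq_zero_iff_mem.2 (hrel c hc i)
  have hlift : Function.Surjective ((LinearMap.ker T).liftQ reduction hker) := fun v => by
    choose c hc using fun i => Ideal.Quotient.mk_surjective (v i)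
    exact ⟨Submodule.Quotient.mk c, funext hc⟩
  exact ⟨((LinearMap.ker T).liftQ reduction hker).comp
    (T.quotKerEquivOfSurjective hT).symm.toLinearMap,
    hlift.comp (T.quotKerEquivOfSurjective hT).symm.surjective⟩

lemma spanFinrank_top_eq_card {I : Ideal A} (hI : I ≠ ⊤) {ι : Type w} [Fintype ι] {g : ι → M}
    (hspan : Submodule.span A (Set.range g) = ⊤)
    (hrel : ∀ c : ι → A, ∑ i, c i • g i = 0 → ∀ i, c i ∈ I) :
    (⊤ : Submodule A M).spanFinrank = Fintype.card ι := by
  apply le_antisymm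
  · calc (⊤ : Submodule A M).spanFinrank = (Submodule.span A (Set.range g)).spanFinrank := by
          rw [hspan]
      _ ≤ (Set.range g).ncard :=
          Submodule.spanFinrank_span_le_ncard_of_finite (Set.finite_range g)
      _ ≤ Fintype.card ι := by
          simpa [← Set.image_univ, Set.ncard_univ] using Set.ncard_image_le (f := g) Set.finite_univ
  · have : Nontrivial (A ⧸ I) := Ideal.Quotient.nontrivial_iff.2 hI
    obtain ⟨φ, hφ⟩ := exists_surjective_semilinearMap_quotient hspan hrel
    calc Fintype.card ι = Module.finrank (A ⧸ I) (ι → A ⧸ I) := (Module.finrank_pi _).symm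
      _ = (⊤ : Submodule (A ⧸ I) (ι → A ⧸ I)).spanFinrank :=
          Module.finrank_eq_spanFinrank_of_free
      _ ≤ (⊤ : Submodule A M).spanFinrank := by
          rw [← LinearMap.range_eq_top.2 hφ, ← Submodule.map_top]
          exact Submodule.spanFinrank_map_le_of_fg _ ⟨_, by
            rw [Set.Finite.coe_toFinset (Set.finite_range g), hspan]⟩

lemma finrank_eq_of_smul_mem [IsDomain A] [Module.IsTorsionFree A M] [IsNoetherian A M]
    {K : Submodule A M} {a : A} (ha : a ≠ 0) (hK : ∀ m, a • m ∈ K) :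
    Module.finrank A K = Module.finrank A M :=
  le_antisymm (LinearMap.finrank_le_finrank_of_injective K.subtype_injective)
    (LinearMap.finrank_le_finrank_of_injective
      (f := (LinearMap.lsmul A M a).codRestrict K hK)
      ((LinearMap.injective_codRestrict_iff hK).2 (smul_right_injective M ha)))

end

variable {k : Type u} [Field k]

lemma mem_span_X_iff {s : PolyRing k} :
    s ∈ Ideal.span (Set.range X) ↔ constantCoeff s = 0 := by
  rw [← Set.image_univ, mem_ideal_span_X_image, constantCoeff_eq, ← notMem_support_iff]
  refine ⟨fun h h0 => by simpa using h 0 h0, fun h m hm => ?_⟩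
  obtain ⟨i, hi⟩ := Finsupp.ne_iff.1 (ne_of_mem_of_not_mem hm h)
  exact ⟨i, trivial, hi⟩

/-- A `ℤ`-grading of an `S`-module, encoded by its projections onto the homogeneous components. -/
structure GradedProjections (k : Type u) [Field k] (N : Type v) [AddCommGroup N]
    [Module (PolyRing k) N] where
  /-- The projection onto the component of degree `j`. -/
  proj : ℤ → N →+ N
  proj_proj : ∀ j n, proj j (proj j n) = proj j n
  proj_smul : ∀ (i j : ℤ) (r : PolyRing k) (n : N), proj j n = n →
    proj i (r • n) = homogComp (i - j) r • n
  exists_sum_proj : ∀ n, ∃ t : Finset ℤ, ∀ t', t ⊆ t' → ∑ j ∈ t', proj j n = n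

namespace GradedProjections

/-- The graded free module `⨁ᵢ S(-aᵢ)`. -/
def free {n : ℕ} (a : Fin n → ℤ) : GradedProjections k (Fin n → PolyRing k) where
  proj j :=
    { toFun := fun v i => homogComp (j - a i) (v i)
      map_zero' := by ext1 i; simp
      map_add' := fun v w => by ext1 i; simp }
  proj_proj j v := funext fun i => homogComp_self (homogComp_mem _ (v i))
  proj_smul i j r v hv := by
    ext1 l
    have hl : v l ∈ polyDeg k (j - a l) := congrFun hv l ▸ homogComp_mem _ _
    change homogComp (i - a l) (r * v l) = homogComp (i - j) r * v l
    rw [homogComp_mul hl, sub_sub_sub_cancel_right]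
  exists_sum_proj v := by
    choose t ht using fun i => exists_sum_homogComp (v i)
    refine ⟨Finset.univ.biUnion fun i => (t i).map (addRightEmbedding (a i)), fun t' h => ?_⟩
    ext1 i
    have hsum := ht i (t'.map (addRightEmbedding (-a i))) fun d hd => by
      refine Finset.mem_map.2 ⟨d + a i, h ?_, add_neg_cancel_right d (a i)⟩
      exact Finset.mem_biUnion.2 ⟨i, Finset.mem_univ i, Finset.mem_map.2 ⟨d, hd, rfl⟩⟩
    rw [Finset.sum_map] at hsum
    simpa [sub_eq_add_neg] using hsum

lemma free_proj_apply {n : ℕ} (a : Fin n → ℤ) (j : ℤ) (v : Fin n → PolyRing k) (i : Fin n) :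
    (free a).proj j v i = homogComp (j - a i) (v i) := rfl

variable {N : Type v} [AddCommGroup N] [Module (PolyRing k) N] (G : GradedProjections k N)

/-- The grading of a homogeneous submodule. -/
def restrict (K : Submodule (PolyRing k) N) (hK : ∀ j, ∀ n ∈ K, G.proj j n ∈ K) :
    GradedProjections k K where
  proj j :=
    { toFun := fun n => ⟨G.proj j n, hK j n n.2⟩
      map_zero' := Subtype.ext (map_zero _)
      map_add' := fun m n => Subtype.ext (map_add _ _ _) }
  proj_proj j n := Subtype.ext (G.proj_proj j n)
  proj_smul i j r n hn := Subtype.ext (G.proj_smul i j r n (congrArg Subtype.val hn))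
  exists_sum_proj n := by
    obtain ⟨t, ht⟩ := G.exists_sum_proj n
    refine ⟨t, fun t' h => Subtype.ext ?_⟩
    rw [AddSubmonoidClass.coe_finsetSum]
    exact ht t' h

variable {G}

lemma proj_sum_smul {n : ℕ} {g : Fin n → N} {a : Fin n → ℤ}
    (hg : ∀ i, G.proj (a i) (g i) = g i) (c : Fin n → PolyRing k) (j : ℤ) :
    G.proj j (∑ i, c i • g i) = ∑ i, homogComp (j - a i) (c i) • g i := by
  rw [map_sum]
  exact Finset.sum_congr rfl fun i _ => G.proj_smul _ _ _ _ (hg i)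

variable [Module.Finite (PolyRing k) N]

variable (G)

lemma exists_homogeneous_generators :
    ∃ (n : ℕ) (g : Fin n → N) (a : Fin n → ℤ), (∀ i, G.proj (a i) (g i) = g i) ∧
      Submodule.span (PolyRing k) (Set.range g) = ⊤ := by
  classical
  obtain ⟨s, hs⟩ := (Module.Finite.fg_top : (⊤ : Submodule (PolyRing k) N).FG)
  choose t ht using G.exists_sum_proj
  let T : Finset (ℤ × N) := s.biUnion fun x => (t x).image fun j => (j, G.proj j x)
  let e := T.equivFin.symm
  refine ⟨T.card, fun i => (e i).1.2, fun i => (e i).1.1, fun i => ?_, ?_⟩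
  · obtain ⟨x, -, hx⟩ := Finset.mem_biUnion.1 (e i).2
    obtain ⟨j, -, hj⟩ := Finset.mem_image.1 hx
    change G.proj (e i).1.1 (e i).1.2 = (e i).1.2
    rw [← hj]
    exact G.proj_proj _ _
  · rw [eq_top_iff, ← hs, Submodule.span_le]
    intro x hx
    rw [SetLike.mem_coe, ← ht x (t x) subset_rfl]
    refine Submodule.sum_mem _ fun j hj => Submodule.subset_span ?_
    have hT : (j, G.proj j x) ∈ T :=
      Finset.mem_biUnion.2 ⟨x, hx, Finset.mem_image.2 ⟨j, hj, rfl⟩⟩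
    exact ⟨e.symm ⟨_, hT⟩, by simp⟩

lemma exists_minimal_generators :
    ∃ (n : ℕ) (g : Fin n → N) (a : Fin n → ℤ), (∀ i, G.proj (a i) (g i) = g i) ∧
      Submodule.span (PolyRing k) (Set.range g) = ⊤ ∧
      ∀ c : Fin n → PolyRing k, ∑ i, c i • g i = 0 → ∀ i, constantCoeff (c i) = 0 := by
  classical
  have hex := G.exists_homogeneous_generators
  obtain ⟨g, a, hg, hspan⟩ := Nat.find_spec hex
  have hmin := fun m => Nat.find_min hex (m := m)
  generalize Nat.find hex = n at g a hg hspan hmin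
  refine ⟨n, g, a, hg, hspan, fun c hc i => ?_⟩
  by_contra hne
  obtain ⟨m, rfl⟩ : ∃ m, n = m + 1 := ⟨n - 1, by have := i.2; lia⟩
  -- In degree `a i` the relation `c` expresses `g i` through the other generators.
  refine hmin m m.lt_succ_self ⟨g ∘ i.succAbove, a ∘ i.succAbove, fun l => hg _, ?_⟩
  have hrel := proj_sum_smul hg c (a i)
  rw [hc, map_zero, Fin.sum_univ_succAbove _ i, sub_self, homogComp_zero] at hrel
  have hgi : g i ∈ Submodule.span (PolyRing k) (Set.range (g ∘ i.succAbove)) := by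
    have hinv : g i = (C (constantCoeff (c i))⁻¹ : PolyRing k) •
        ((C (constantCoeff (c i)) : PolyRing k) • g i) := by
      rw [smul_smul, ← C_mul, inv_mul_cancel₀ hne, C_1, one_smul]
    rw [hinv, eq_neg_of_add_eq_zero_left hrel.symm]
    exact Submodule.smul_mem _ _ (neg_mem (Submodule.sum_mem _ fun l _ =>
      Submodule.smul_mem _ _ (Submodule.subset_span ⟨l, rfl⟩)))
  rw [eq_top_iff, ← hspan, Submodule.span_le]
  rintro _ ⟨l, rfl⟩
  rcases Fin.eq_self_or_eq_succAbove i l with rfl | ⟨l, rfl⟩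
  · exact hgi
  · exact Submodule.subset_span ⟨l, rfl⟩

end GradedProjections

end MinimalGenerators

section Presentations

variable {k : Type u} [Field k]

lemma constantCoeff_cubic : constantCoeff (cubic k) = 0 := by
  simp [cubic]

lemma irrelevant_ne_top : irrelevant k ≠ ⊤ := by
  let ε : NodeRing k →+* k := Ideal.Quotient.lift _ constantCoeff fun s hs => by
    obtain ⟨t, rfl⟩ := Ideal.mem_span_singleton.1 hs
    rw [map_mul, constantCoeff_cubic, zero_mul]
  have hle : irrelevant k ≤ RingHom.ker ε := by
    rw [irrelevant, Ideal.span_le]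
    rintro _ ⟨i, rfl⟩
    exact constantCoeff_X k i
  exact fun h => RingHom.ker_ne_top ε (top_le_iff.1 (h ▸ hle))

lemma mk_mem_irrelevant {s : PolyRing k} (hs : constantCoeff s = 0) : π s ∈ irrelevant k := by
  obtain ⟨c, rfl⟩ := Ideal.mem_span_range_iff_exists_fun.1 (mem_span_X_iff.2 hs)
  rw [map_sum]
  refine Ideal.sum_mem _ fun i _ => ?_
  rw [map_mul]
  exact Ideal.mul_mem_left _ _ (Ideal.subset_span ⟨i, rfl⟩)

lemma mk_mem_ringDeg {d : ℤ} {s : PolyRing k} (hs : s ∈ polyDeg k d) : π s ∈ ringDeg k d :=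
  ⟨s, hs, rfl⟩

variable {M : Type v} [AddCommGroup M] [Module (NodeRing k) M] {gr : ℤ → AddSubgroup M} {n : ℕ}

lemma mk_smul_eq_zero {s : PolyRing k} (hs : cubic k ∣ s) (m : M) : π s • m = 0 := by
  rw [mk_eq_zero_iff.2 hs]
  exact zero_smul (NodeRing k) m

section

variable [Module (PolyRing k) M] [IsScalarTower (PolyRing k) (NodeRing k) M]

lemma mk_smul (s : PolyRing k) (m : M) : π s • m = s • m :=
  algebraMap_smul (NodeRing k) s m

lemma IsGradedMCM.koszulExactTwo_X (h : IsGradedMCM (k := k) gr) :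
    KoszulExactTwo (X : Fin 3 → PolyRing k) M := by
  obtain ⟨rs, hrs, hreg, hlen⟩ := h.exists_regular
  have hlen2 : 2 ≤ rs.length := by
    have := two_le_ringKrullDim k
    rw [← hlen] at this
    exact_mod_cast this
  obtain _ | ⟨r, _ | ⟨s, rs⟩⟩ := rs
  · simp at hlen2
  · simp at hlen2
  have hrs2 : RingTheory.Sequence.IsWeaklyRegular M [r, s] := by
    have := hreg.toIsWeaklyRegular
    simp only [RingTheory.Sequence.isWeaklyRegular_cons_iff] at this ⊢
    exact ⟨this.1, this.2.1, .nil _ _⟩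
  have hex : KoszulExactTwo (fun i => π (X i : PolyRing k)) M :=
    koszulExactTwo_of_isWeaklyRegular (hrs r (by simp)) (hrs s (by simp)) hrs2
  intro w hw
  obtain ⟨n, hn⟩ := hex w (cross_eq_zero_iff.2 fun i j => by
    simpa only [mk_smul] using cross_eq_zero_iff.1 hw i j)
  exact ⟨n, fun i => by rw [hn, mk_smul]⟩

lemma span_nodeRing_eq_top {s : Set M} (hs : Submodule.span (PolyRing k) s = ⊤) :
    Submodule.span (NodeRing k) s = ⊤ := by
  apply Submodule.restrictScalars_injective (PolyRing k)
  rw [Submodule.restrictScalars_span _ _ Ideal.Quotient.mk_surjective, hs,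
    Submodule.restrictScalars_top]

lemma spanFinrank_eq_of_span_eq_top {g : Fin n → M}
    (hspan : Submodule.span (PolyRing k) (Set.range g) = ⊤)
    (hmin : ∀ c : Fin n → PolyRing k, ∑ i, c i • g i = 0 → ∀ i, constantCoeff (c i) = 0) :
    (⊤ : Submodule (NodeRing k) M).spanFinrank = n := by
  rw [spanFinrank_top_eq_card irrelevant_ne_top (span_nodeRing_eq_top hspan), Fintype.card_fin]
  intro c hc
  obtain ⟨c, rfl⟩ := Ideal.Quotient.mk_surjective.comp_left c
  exact fun i => mk_mem_irrelevant (hmin c (by simpa only [Function.comp, mk_smul] using hc) i)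

lemma IsGrading.exists_gradedProjections (h : IsGrading (k := k) gr) :
    ∃ G : GradedProjections k M, ∀ j m, G.proj j m = m ↔ m ∈ gr j := by
  classical
  let := h.isInternal.chooseDecomposition
  have hmem {j : ℤ} {m : M} (hm : m ∈ gr j) (i : ℤ) :
      (DirectSum.decompose gr m i : M) = if i = j then m else 0 := by
    split_ifs with hij
    · exact hij ▸ DirectSum.decompose_of_mem_same gr hm
    · exact DirectSum.decompose_of_mem_ne gr hm (Ne.symm hij)
  let G : GradedProjections k M :=
    { proj := fun j => AddMonoidHom.mk' (fun m => (DirectSum.decompose gr m j : M)) (by simp)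
      proj_proj := fun j m => by
        change (DirectSum.decompose gr (DirectSum.decompose gr m j : M) j : M) = _
        rw [hmem (SetLike.coe_mem _), if_pos rfl]
        rfl
      proj_smul := fun i j r m hm => ?_
      exists_sum_proj := fun m => by
        refine ⟨(DirectSum.decompose gr m).support, fun t' ht => ?_⟩
        rw [← Finset.sum_subset ht fun j _ hj => by simpa using hj]
        exact DirectSum.sum_support_decompose gr m }
  · exact ⟨G, fun j m => ⟨fun hm => hm ▸ SetLike.coe_mem _, fun hm => by
      simp [G, hmem hm]⟩⟩
  · change (DirectSum.decompose gr m j : M) = m at hm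
    change (DirectSum.decompose gr (r • m) i : M) = _
    have hmj : m ∈ gr j := hm ▸ SetLike.coe_mem _
    obtain ⟨t, ht⟩ := exists_sum_homogComp r
    rw [← ht t subset_rfl, Finset.sum_smul, DirectSum.decompose_sum, DFinsupp.finsetSum_apply,
      AddSubmonoidClass.coe_finsetSum, map_sum, Finset.sum_smul]
    refine Finset.sum_congr rfl fun d _ => ?_
    have hd : homogComp d r • m ∈ gr (d + j) := by
      rw [← mk_smul]
      exact h.smul_mem _ _ _ _ (mk_mem_ringDeg (homogComp_mem d r)) hmj
    rw [hmem hd, homogComp_of_mem (homogComp_mem d r), ite_smul, zero_smul]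
    simp only [sub_eq_iff_eq_add]

end

/-- Homogeneity of degree zero of `A : ⨁ⱼ S(-bⱼ) → ⨁ᵢ S(-aᵢ)`. -/
def IsHomogeneousMatrix (a b : Fin n → ℤ) (A : Matrix (Fin n) (Fin n) (PolyRing k)) : Prop :=
  ∀ i j, A i j ∈ polyDeg k (b j - a i)

lemma exists_matrix_of_koszulExactOne {a : Fin n → ℤ} {f : PolyRing k} (hf : f ≠ 0)
    {K : Submodule (PolyRing k) (Fin n → PolyRing k)} (hfK : ∀ v, f • v ∈ K)
    (hhom : ∀ j, ∀ v ∈ K, (GradedProjections.free a).proj j v ∈ K)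
    (hK : KoszulExactOne (X : Fin 3 → PolyRing k) K) :
    ∃ (b : Fin n → ℤ) (A : Matrix (Fin n) (Fin n) (PolyRing k)),
      IsHomogeneousMatrix a b A ∧ ∀ v, v ∈ K ↔ ∃ w, A *ᵥ w = v := by
  obtain ⟨m, l, b, hl, hspan, hmin⟩ :=
    ((GradedProjections.free a).restrict K hhom).exists_minimal_generators
  have hX : Ideal.span (Set.range (X : Fin 3 → PolyRing k)) ≠ ⊤ :=
    (Ideal.ne_top_iff_one _).2 fun h => by simpa using mem_span_X_iff.1 h
  have hind : LinearIndependent (PolyRing k) l :=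
    linearIndependent_of_koszulExactOne hX hK hspan fun c hc i => mem_span_X_iff.2 (hmin c hc i)
  obtain rfl : m = n := by
    have hm := Module.finrank_eq_card_basis (Module.Basis.mk hind hspan.ge)
    rwa [finrank_eq_of_smul_mem hf hfK, Module.finrank_fin_fun, Fintype.card_fin, eq_comm] at hm
  refine ⟨b, Matrix.of fun i j => (l j).1 i, fun i j => ?_, fun v => ?_⟩
  · have hlj := congrFun (congrArg Subtype.val (hl j)) i
    rw [Matrix.of_apply, ← hlj]
    exact homogComp_mem _ _
  · have hsum (w : Fin m → PolyRing k) :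
        Matrix.of (fun i j => (l j).1 i) *ᵥ w = (∑ j, w j • l j : K) := by
      ext1 i
      simp [Matrix.mulVec, dotProduct, mul_comm]
    constructor
    · intro hv
      have hmem : (⟨v, hv⟩ : K) ∈ Submodule.span (PolyRing k) (Set.range l) := hspan ▸ trivial
      obtain ⟨w, hw⟩ := (Submodule.mem_span_range_iff_exists_fun _).1 hmem
      exact ⟨w, by rw [hsum, hw]⟩
    · rintro ⟨w, rfl⟩
      rw [hsum]
      exact SetLike.coe_mem _

/-- A square homogeneous presentation: the `g i`, homogeneous of degree `a i`, generate `M`, and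
the columns of `A` generate their relations with coefficients in `S`. -/
structure IsPresentation (gr : ℤ → AddSubgroup M) (g : Fin n → M) (a : Fin n → ℤ)
    (A : Matrix (Fin n) (Fin n) (PolyRing k)) : Prop where
  mem : ∀ i, g i ∈ gr (a i)
  span_eq_top : Submodule.span (NodeRing k) (Set.range g) = ⊤
  sum_smul_eq_zero_iff : ∀ v : Fin n → PolyRing k,
    ∑ i, π (v i) • g i = 0 ↔ ∃ w, A *ᵥ w = v

lemma IsGradedMCM.exists_isPresentation (h : IsGradedMCM (k := k) gr)
    (hn : (⊤ : Submodule (NodeRing k) M).spanFinrank = n) :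
    ∃ (g : Fin n → M) (a b : Fin n → ℤ) (A : Matrix (Fin n) (Fin n) (PolyRing k)),
      IsPresentation gr g a A ∧ IsHomogeneousMatrix a b A ∧ ∀ i j, constantCoeff (A i j) = 0 := by
  let : Module (PolyRing k) M := Module.compHom M (π : PolyRing k →+* NodeRing k)
  have : IsScalarTower (PolyRing k) (NodeRing k) M := ⟨fun s r m => mul_smul (π s) r m⟩
  have := h.finite
  have : Module.Finite (PolyRing k) M := Module.Finite.trans (NodeRing k) M
  obtain ⟨G, hG⟩ := h.isGrading.exists_gradedProjections
  obtain ⟨m, g, a, hg, hspan, hmin⟩ := G.exists_minimal_generators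
  obtain rfl : m = n := (spanFinrank_eq_of_span_eq_top hspan hmin).symm.trans hn
  let T := Fintype.linearCombination (PolyRing k) g
  have hT : Function.Surjective T := by
    rw [← LinearMap.range_eq_top, Fintype.range_linearCombination, hspan]
  have hhom (j : ℤ) (v) (hv : v ∈ LinearMap.ker T) :
      (GradedProjections.free a).proj j v ∈ LinearMap.ker T := by
    rw [LinearMap.mem_ker, Fintype.linearCombination_apply] at hv ⊢
    simp only [GradedProjections.free_proj_apply]
    rw [← GradedProjections.proj_sum_smul hg, hv, map_zero]
  have hfK (v) : cubic k • v ∈ LinearMap.ker T := by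
    rw [LinearMap.mem_ker, map_smul, ← mk_smul, mk_smul_eq_zero dvd_rfl]
  obtain ⟨b, A, hA, hker⟩ := exists_matrix_of_koszulExactOne (cubic_ne_zero k) hfK hhom
    (koszulExactOne_ker hT koszulExactOne_X.pi h.koszulExactTwo_X)
  refine ⟨g, a, b, A, ⟨fun i => (hG _ _).1 (hg i), span_nodeRing_eq_top hspan, fun v => ?_⟩,
    hA, fun i j => ?_⟩
  · simp only [mk_smul, ← hker, LinearMap.mem_ker, T, Fintype.linearCombination_apply]
  · refine hmin (A.col j) ?_ i
    rw [← Fintype.linearCombination_apply, ← LinearMap.mem_ker, hker]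
    exact ⟨Pi.single j 1, A.mulVec_single_one j⟩

end Presentations

section PresentationMatrices

variable {k : Type u} [Field k] {n : ℕ}

lemma matMap_comp_mk (A : Matrix (Fin n) (Fin n) (PolyRing k)) (v : Fin n → PolyRing k) :
    matMap A (π ∘ v) = π ∘ (A *ᵥ v) :=
  funext fun i => (RingHom.map_mulVec π A v i).symm

variable {M : Type v} [AddCommGroup M] [Module (NodeRing k) M] {gr : ℤ → AddSubgroup M}

lemma IsGrading.mk_smul_mem (hgr : IsGrading (k := k) gr) {i j : ℤ} {s : PolyRing k} {m : M}
    (hs : s ∈ polyDeg k i) (hm : m ∈ gr j) : π s • m ∈ gr (i + j) :=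
  hgr.smul_mem _ _ _ _ (mk_mem_ringDeg hs) hm

lemma sum_smul_sum_smul (P : Matrix (Fin n) (Fin n) (PolyRing k)) (g : Fin n → M)
    (v : Fin n → PolyRing k) :
    ∑ j, π (v j) • ∑ i, π (P i j) • g i = ∑ i, π ((P *ᵥ v) i) • g i := by
  simp only [Finset.smul_sum, Matrix.mulVec, dotProduct, map_sum, Finset.sum_smul, smul_smul,
    ← map_mul]
  rw [Finset.sum_comm]
  simp only [mul_comm]

variable {g : Fin n → M} {a : Fin n → ℤ} {A : Matrix (Fin n) (Fin n) (PolyRing k)}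

namespace IsPresentation

lemma exists_sum_smul_eq (h : IsPresentation gr g a A) (m : M) :
    ∃ v : Fin n → PolyRing k, ∑ i, π (v i) • g i = m := by
  have hm : m ∈ Submodule.span (NodeRing k) (Set.range g) := h.span_eq_top ▸ trivial
  obtain ⟨c, rfl⟩ := (Submodule.mem_span_range_iff_exists_fun _).1 hm
  obtain ⟨v, rfl⟩ := Ideal.Quotient.mk_surjective.comp_left c
  exact ⟨v, rfl⟩

lemma submatrix (h : IsPresentation gr g a A) (σ τ : Equiv.Perm (Fin n)) :
    IsPresentation gr (g ∘ σ) (a ∘ σ) (A.submatrix σ τ) where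
  mem i := h.mem (σ i)
  span_eq_top := by rw [σ.surjective.range_comp, h.span_eq_top]
  sum_smul_eq_zero_iff v := by
    have hsum : ∑ i, π (v i) • (g ∘ σ) i = ∑ i, π ((v ∘ σ.symm) i) • g i :=
      Fintype.sum_equiv σ _ _ fun i => by simp
    rw [hsum, h.sum_smul_eq_zero_iff]
    simp only [Matrix.submatrix_mulVec_equiv]
    constructor
    · rintro ⟨w, hw⟩
      exact ⟨w ∘ τ, by simp [Function.comp_assoc, hw]⟩
    · rintro ⟨w, rfl⟩
      exact ⟨w ∘ τ.symm, by simp [Function.comp_assoc]⟩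

lemma of_mul (hgr : IsGrading (k := k) gr) {P B Q : Matrix (Fin n) (Fin n) (PolyRing k)}
    (h : IsPresentation gr g a (P * B * Q)) (hP : IsUnit P.det) (hQ : IsUnit Q.det)
    {a' : Fin n → ℤ} (hdeg : IsHomogeneousMatrix a a' P) :
    IsPresentation gr (fun j => ∑ i, π (P i j) • g i) a' B where
  mem j := sum_mem fun i _ => by simpa using hgr.mk_smul_mem (hdeg i j) (h.mem i)
  span_eq_top := eq_top_iff.2 fun m _ => by
    obtain ⟨v, rfl⟩ := h.exists_sum_smul_eq m
    rw [Submodule.mem_span_range_iff_exists_fun]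
    refine ⟨π ∘ (P⁻¹ *ᵥ v), (sum_smul_sum_smul P g (P⁻¹ *ᵥ v)).trans ?_⟩
    rw [Matrix.mulVec_mulVec, Matrix.mul_nonsing_inv _ hP, Matrix.one_mulVec]
  sum_smul_eq_zero_iff v := by
    rw [sum_smul_sum_smul, h.sum_smul_eq_zero_iff]
    have hPinj := Matrix.mulVec_injective_of_isUnit ((Matrix.isUnit_iff_isUnit_det P).2 hP)
    simp only [← Matrix.mulVec_mulVec, hPinj.eq_iff]
    constructor
    · rintro ⟨w, hw⟩
      exact ⟨Q *ᵥ w, hw⟩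
    · rintro ⟨w, hw⟩
      exact ⟨Q⁻¹ *ᵥ w, by
        rw [Matrix.mulVec_mulVec, Matrix.mulVec_mulVec, Matrix.mul_nonsing_inv_cancel_right _ _ hQ,
          hw]⟩

lemma ker_linearCombination (h : IsPresentation gr g a A) :
    LinearMap.ker (Fintype.linearCombination (NodeRing k) g) = LinearMap.range (matMap A) := by
  ext v
  obtain ⟨v, rfl⟩ := Ideal.Quotient.mk_surjective.comp_left v
  rw [LinearMap.mem_ker, Fintype.linearCombination_apply]
  refine (h.sum_smul_eq_zero_iff v).trans ⟨?_, ?_⟩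
  · rintro ⟨w, rfl⟩
    exact ⟨π ∘ w, matMap_comp_mk A w⟩
  · rintro ⟨w, hw⟩
    obtain ⟨w, rfl⟩ := Ideal.Quotient.mk_surjective.comp_left w
    rw [matMap_comp_mk] at hw
    have hzero := (h.sum_smul_eq_zero_iff _).2 ⟨w, rfl⟩
    exact (h.sum_smul_eq_zero_iff v).1 <| (Finset.sum_congr rfl fun i _ =>
      congrArg (· • g i) (congrFun hw i).symm).trans hzero

lemma exists_homogeneous_sum_smul_eq (hgr : IsGrading (k := k) gr) (h : IsPresentation gr g a A)
    {j : ℤ} {m : M} (hm : m ∈ gr j) :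
    ∃ v : Fin n → PolyRing k, (∀ i, v i ∈ polyDeg k (j - a i)) ∧ ∑ i, π (v i) • g i = m := by
  let : Module (PolyRing k) M := Module.compHom M (π : PolyRing k →+* NodeRing k)
  have : IsScalarTower (PolyRing k) (NodeRing k) M := ⟨fun s r m => mul_smul (π s) r m⟩
  obtain ⟨G, hG⟩ := hgr.exists_gradedProjections
  obtain ⟨v, rfl⟩ := h.exists_sum_smul_eq m
  refine ⟨fun i => homogComp (j - a i) (v i), fun i => homogComp_mem _ _, ?_⟩
  have hproj := (hG _ _).2 hm
  simp only [mk_smul] at hproj ⊢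
  rwa [GradedProjections.proj_sum_smul fun i => (hG _ _).2 (h.mem i)] at hproj

lemma gradedIso (hgr : IsGrading (k := k) gr) (h : IsPresentation gr g a A) {a' : Fin n → ℤ}
    {d : ℤ} (ha : ∀ i, a' i = a i + d) : GradedIso k gr (cokerDeg A a') d := by
  have hsurj : Function.Surjective (Fintype.linearCombination (NodeRing k) g) := by
    rw [← LinearMap.range_eq_top, Fintype.range_linearCombination, h.span_eq_top]
  let e : Coker A ≃ₗ[NodeRing k] M :=
    (Submodule.quotEquivOfEq _ _ h.ker_linearCombination.symm).trans
      ((Fintype.linearCombination (NodeRing k) g).quotKerEquivOfSurjective hsurj)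
  have he (v) : e (Submodule.mkQ _ v) = ∑ i, v i • g i := rfl
  refine ⟨e.symm, fun j => le_antisymm ?_ ?_⟩
  · rintro _ ⟨m, hm, rfl⟩
    obtain ⟨v, hv, rfl⟩ := exists_homogeneous_sum_smul_eq hgr h hm
    refine ⟨π ∘ v, fun i _ => mk_mem_ringDeg ?_, e.eq_symm_apply.2 (he _)⟩
    simpa [ha] using hv i
  · rintro _ ⟨v, hv, rfl⟩
    refine ⟨∑ i, v i • g i, sum_mem fun i _ => ?_, e.symm_apply_eq.2 (he v).symm⟩
    have := hgr.smul_mem _ _ _ _ (hv i trivial) (h.mem i)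
    simpa [ha] using this

lemma exists_mul_eq (h : IsPresentation gr g a A) :
    ∃ B : Matrix (Fin n) (Fin n) (PolyRing k), A * B = cubic k • 1 := by
  have hcol (j : Fin n) : ∃ w, A *ᵥ w = Pi.single j (cubic k) :=
    (h.sum_smul_eq_zero_iff _).1 (Finset.sum_eq_zero fun i _ => mk_smul_eq_zero (by
      by_cases hij : i = j <;> simp [hij]) _)
  choose w hw using hcol
  refine ⟨Matrix.of fun i j => w j i, ?_⟩
  ext1 i j
  simpa [Matrix.mul_apply, Matrix.mulVec, dotProduct, Matrix.one_apply, Pi.single_apply]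
    using congrFun (hw j) i

lemma free_of_cubic_dvd (h : IsPresentation gr g a A) (hA : ∀ i j, cubic k ∣ A i j) :
    Module.Free (NodeRing k) M := by
  refine Module.Free.of_basis (Module.Basis.mk (v := g) ?_ h.span_eq_top.ge)
  rw [Fintype.linearIndependent_iff]
  intro c hc i
  obtain ⟨c, rfl⟩ := Ideal.Quotient.mk_surjective.comp_left c
  obtain ⟨w, rfl⟩ := (h.sum_smul_eq_zero_iff c).1 hc
  have hdvd : cubic k ∣ ∑ j, A i j * w j := Finset.dvd_sum fun j _ => (hA i j).mul_right _
  exact mk_eq_zero_iff.2 hdvd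

lemma associated_det_cubic {g : Fin 2 → M} {a : Fin 2 → ℤ}
    {A : Matrix (Fin 2) (Fin 2) (PolyRing k)} (h : IsPresentation gr g a A)
    (hfree : ¬ Module.Free (NodeRing k) M) (hcoeff : ∀ i j, constantCoeff (A i j) = 0) :
    Associated A.det (cubic k) := by
  obtain ⟨B, hAB⟩ := h.exists_mul_eq
  have hdet : A.det * B.det = cubic k ^ 2 := by
    rw [← Matrix.det_mul, hAB, Matrix.det_smul, Matrix.det_one, Fintype.card_fin, mul_one]
  obtain ⟨i, hi, hassoc⟩ := (dvd_prime_pow (cubic_prime k) 2).1 ⟨_, hdet.symm⟩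
  interval_cases i
  · rw [pow_zero, associated_one_iff_isUnit] at hassoc
    have := hassoc.map (constantCoeff (R := k) (σ := Fin 3))
    simp [Matrix.det_fin_two, hcoeff] at this
  · rwa [pow_one] at hassoc
  · obtain ⟨u, hu⟩ := hassoc
    have hA0 : A.det ≠ 0 := left_ne_zero_of_mul (hdet ▸ pow_ne_zero 2 (cubic_ne_zero k))
    have hB : IsUnit B.det := mul_left_cancel₀ hA0 (hdet.trans hu.symm) ▸ u.isUnit
    refine absurd (h.free_of_cubic_dvd fun i j => ?_) hfree
    have hA : A = cubic k • B⁻¹ := by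
      rw [← Matrix.mul_one A, ← Matrix.mul_nonsing_inv B hB, ← mul_assoc, hAB, smul_mul_assoc,
        one_mul]
    rw [hA]
    exact ⟨_, rfl⟩

end IsPresentation

end PresentationMatrices

section Degrees

variable {k : Type u} [Field k]

lemma not_isUnit_of_constantCoeff_eq_zero {s : PolyRing k} (hs : constantCoeff s = 0) :
    ¬ IsUnit s :=
  fun h => (h.map (constantCoeff (σ := Fin 3) (R := k))).ne_zero hs

lemma entry_ne_zero_of_irreducible_det {S : Type*} [CommRing S] {A : Matrix (Fin 2) (Fin 2) S}
    (hA : Irreducible A.det) (hunit : ∀ i j, ¬ IsUnit (A i j)) (i j : Fin 2) : A i j ≠ 0 := by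
  intro hij
  have hprod : ∃ i₁ j₁ i₂ j₂, Associated (A.det) (A i₁ j₁ * A i₂ j₂) := by
    rw [Matrix.det_fin_two]
    fin_cases i <;> fin_cases j <;> simp only [Fin.zero_eta, Fin.mk_one] at hij <;> rw [hij]
    · exact ⟨0, 1, 1, 0, by rw [zero_mul, zero_sub]; exact (Associated.refl _).neg_left⟩
    · exact ⟨0, 0, 1, 1, by rw [zero_mul, sub_zero]⟩
    · exact ⟨0, 0, 1, 1, by rw [mul_zero, sub_zero]⟩
    · exact ⟨0, 1, 1, 0, by rw [mul_zero, zero_sub]; exact (Associated.refl _).neg_left⟩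
  obtain ⟨i₁, j₁, i₂, j₂, hprod⟩ := hprod
  exact ((hprod.irreducible hA).isUnit_or_isUnit rfl).elim (hunit _ _) (hunit _ _)

lemma eq_zero_of_sum_C_mul_col_eq_zero {A : Matrix (Fin 2) (Fin 2) (PolyRing k)}
    (hA : Irreducible A.det) (hcoeff : ∀ i j, constantCoeff (A i j) = 0) {w : Fin 2 → k}
    (hw : ∑ i, C (w i) * A i 0 = 0) : w = 0 := by
  have hmul (i j : Fin 2) (e : k) (hdet : C (w i) * A.det =
      A j 0 * (C e * (C (w 0) * A 0 1 + C (w 1) * A 1 1))) : w i = 0 := by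
    by_contra hwi
    have hunit : IsUnit (C (w i) : PolyRing k) := (IsUnit.mk0 _ hwi).map C
    have hirr := (associated_unit_mul_left A.det _ hunit).symm.irreducible hA
    rcases hirr.isUnit_or_isUnit hdet with h | h
    · exact not_isUnit_of_constantCoeff_eq_zero (hcoeff _ _) h
    · exact not_isUnit_of_constantCoeff_eq_zero (by simp [hcoeff]) h
  rw [Fin.sum_univ_two] at hw
  ext i
  fin_cases i
  · refine hmul 0 1 (-1) ?_
    rw [Matrix.det_fin_two, map_neg, map_one]
    linear_combination A 1 1 * hw
  · refine hmul 1 0 1 ?_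
    rw [Matrix.det_fin_two, map_one]
    linear_combination -A 0 1 * hw

lemma det_mem_polyDeg {a b : Fin 2 → ℤ} {A : Matrix (Fin 2) (Fin 2) (PolyRing k)}
    (hA : IsHomogeneousMatrix a b A) : A.det ∈ polyDeg k (b 0 + b 1 - a 0 - a 1) := by
  rw [Matrix.det_fin_two]
  refine sub_mem ?_ ?_
  · convert mul_mem_polyDeg (hA 0 0) (hA 1 1) using 2
    ring
  · convert mul_mem_polyDeg (hA 0 1) (hA 1 0) using 2
    ring

lemma exists_eq_C_mul_cubic_of_associated {s : PolyRing k} (hs : Associated s (cubic k)) :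
    ∃ c : k, c ≠ 0 ∧ s = C c * cubic k := by
  obtain ⟨u, rfl⟩ := hs.symm
  obtain ⟨c, hc, hu⟩ := MvPolynomial.isUnit_iff_eq_C_of_isReduced.1 u.isUnit
  exact ⟨c, hc.ne_zero, by rw [hu, mul_comm]⟩

lemma degrees_of_associated_det_cubic {a b : Fin 2 → ℤ} {A : Matrix (Fin 2) (Fin 2) (PolyRing k)}
    (hA : IsHomogeneousMatrix a b A) (hdet : Associated A.det (cubic k))
    (hcoeff : ∀ i j, constantCoeff (A i j) = 0) :
    ∃ (σ τ : Equiv.Perm (Fin 2)) (c : ℤ),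
      (a ∘ σ = ![c, c] ∧ b ∘ τ = ![c + 1, c + 2]) ∨
        (a ∘ σ = ![c, c + 1] ∧ b ∘ τ = ![c + 2, c + 2]) := by
  have hne := entry_ne_zero_of_irreducible_det (hdet.symm.irreducible (cubic_irreducible k))
    fun i j => not_isUnit_of_constantCoeff_eq_zero (hcoeff i j)
  have hpos (i j) : 0 < b j - a i := degree_pos_of_mem (hA i j) (hne i j) (hcoeff i j)
  have hsum : b 0 + b 1 - a 0 - a 1 = 3 := by
    obtain ⟨c, hc, hdetc⟩ := exists_eq_C_mul_cubic_of_associated hdet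
    refine degree_eq_of_mem (hdetc ▸ det_mem_polyDeg hA)
      (C_mul_mem_polyDeg c (cubic_mem_polyDeg k)) ?_
    exact mul_ne_zero ((map_ne_zero_iff C (C_injective _ _)).2 hc) (cubic_ne_zero k)
  have hpair (c : Fin 2 → ℤ) (σ : Equiv.Perm (Fin 2)) : c ∘ σ = ![c (σ 0), c (σ 1)] :=
    List.ofFn_inj.1 rfl
  have hcases : (a 0 = a 1 ∧ (b 0 = a 0 + 1 ∧ b 1 = a 0 + 2 ∨ b 0 = a 0 + 2 ∧ b 1 = a 0 + 1)) ∨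
      (b 0 = b 1 ∧ (b 0 = a 0 + 2 ∧ a 1 = a 0 + 1 ∨ b 0 = a 1 + 2 ∧ a 0 = a 1 + 1)) := by
    have := hpos 0 0
    have := hpos 0 1
    have := hpos 1 0
    have := hpos 1 1
    omega
  simp only [hpair]
  obtain ⟨ha, ⟨hb0, hb1⟩ | ⟨hb0, hb1⟩⟩ | ⟨hb, ⟨hb0, ha⟩ | ⟨hb0, ha⟩⟩ := hcases
  · exact ⟨1, 1, a 0, .inl (by simp [ha, hb0, hb1])⟩
  · exact ⟨1, Equiv.swap 0 1, a 0, .inl (by simp [ha, hb0, hb1])⟩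
  · exact ⟨1, 1, a 0, .inr (by simp [ha, ← hb, hb0])⟩
  · exact ⟨Equiv.swap 0 1, 1, a 1, .inr (by simp [ha, ← hb, hb0])⟩

end Degrees

section Points

variable {k : Type u} [Field k] {p q : ℙ k (Fin 3 → k)}

lemma eval_cubic (v : Fin 3 → k) :
    eval v (cubic k) = v 0 ^ 3 + v 0 ^ 2 * v 2 - v 1 ^ 2 * v 2 := by
  simp [cubic]

lemma phi_eq_phiInf_or_phiAff (hp : p ∈ curve k) :
    (∃ c, c ≠ 0 ∧ p.rep = ![0, c, 0] ∧ phi p = phiInf k) ∨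
      ∃ a b c : k, c ≠ 0 ∧ p.rep = ![c * a, c * b, c] ∧ b ^ 2 = a ^ 3 + a ^ 2 ∧
        phi p = phiAff a b := by
  have hcubic : p.rep 0 ^ 3 + p.rep 0 ^ 2 * p.rep 2 - p.rep 1 ^ 2 * p.rep 2 = 0 :=
    (eval_cubic _).symm.trans hp
  by_cases h2 : p.rep 2 = 0
  · have h0 : p.rep 0 = 0 := by simpa [h2] using hcubic
    have hrep : p.rep = ![0, p.rep 1, 0] := by
      ext i
      fin_cases i
      exacts [h0, rfl, h2]
    refine .inl ⟨p.rep 1, fun h1 => p.rep_nonzero ?_, hrep, if_pos h2⟩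
    rw [hrep, h1]
    simp
  · refine .inr ⟨_, _, p.rep 2, h2, ?_, ?_, if_neg h2⟩
    · ext i
      fin_cases i <;> simp [mul_div_cancel₀ _ h2]
    · field_simp
      linear_combination -hcubic

lemma eval_rep_phi_col_zero (hp : p ∈ curve k) (i : Fin 2) : eval p.rep (phi p i 0) = 0 := by
  obtain ⟨c, -, hrep, hphi⟩ | ⟨a, b, c, -, hrep, -, hphi⟩ := phi_eq_phiInf_or_phiAff hp <;>
    rw [hrep, hphi] <;> fin_cases i <;> simp [phiInf, phiAff, mul_comm]

lemma eq_of_eval_rep_phi_col_zero (hq : q ∈ curve k) (h : ∀ i, eval p.rep (phi q i 0) = 0) :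
    p = q := by
  suffices ∃ t : k, t • q.rep = p.rep by
    rw [← p.mk_rep, ← q.mk_rep, Projectivization.mk_eq_mk_iff']
    exact this
  have h0 := h 0
  have h1 := h 1
  obtain ⟨c, hc, hrep, hphi⟩ | ⟨a, b, c, hc, hrep, -, hphi⟩ := phi_eq_phiInf_or_phiAff hq
  · simp only [hphi, phiInf, Matrix.of_apply, Matrix.cons_val, map_add, eval_X] at h0 h1
    have h00 : p.rep 0 = 0 := by linear_combination h0 - h1
    refine ⟨p.rep 1 / c, ?_⟩
    ext i
    fin_cases i <;> simp [hrep, h00, h1, hc]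
  · simp only [hphi, phiAff, Matrix.of_apply, Matrix.cons_val, map_sub, map_mul, eval_X, eval_C,
      sub_eq_zero] at h0 h1
    refine ⟨p.rep 2 / c, ?_⟩
    ext i
    fin_cases i <;> simp [hrep, h0, h1] <;> field_simp

lemma exists_eq_of_eval_rep_eq_zero (hp : p ∈ curve k) {l : PolyRing k} (hl : l ∈ polyDeg k 1)
    (h : eval p.rep l = 0) : ∃ w : Fin 2 → k, l = ∑ i, C (w i) * phi p i 0 := by
  obtain ⟨e, rfl⟩ := exists_linear_of_mem_polyDeg_one hl
  obtain ⟨c, hc, hrep, hphi⟩ | ⟨a, b, c, hc, hrep, -, hphi⟩ := phi_eq_phiInf_or_phiAff hp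
  · have h1 : e 1 = 0 := by simpa [Fin.sum_univ_three, hrep, hc] using h
    refine ⟨![e 0, e 2 - e 0], ?_⟩
    simp only [Fin.sum_univ_three, Fin.sum_univ_two, hphi, phiInf, h1, Matrix.of_apply,
      Matrix.cons_val, map_sub, map_zero]
    ring
  · have h2 : e 2 = -(e 0 * a + e 1 * b) := by
      refine mul_left_cancel₀ hc ?_
      simp only [Fin.sum_univ_three, hrep, map_add, map_mul, eval_C, eval_X, Matrix.cons_val] at h
      linear_combination h
    refine ⟨![e 0, e 1], ?_⟩
    simp only [Fin.sum_univ_three, Fin.sum_univ_two, hphi, phiAff, h2, Matrix.of_apply,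
      Matrix.cons_val, map_neg, map_add, map_mul]
    ring

lemma psi_eq_adjugate (p : ℙ k (Fin 3 → k)) : psi p = (phi p).adjugate := by
  rw [phi, psi]
  split_ifs <;> rw [Matrix.adjugate_fin_two]
  · simp [phiInf, psiInf]
  · simp [phiAff, psiAff]

lemma det_phi (hp : p ∈ curve k) : (phi p).det = cubic k := by
  obtain ⟨-, -, -, hphi⟩ | ⟨a, b, -, -, -, hab, hphi⟩ := phi_eq_phiInf_or_phiAff hp
  · simp only [hphi, phiInf, Matrix.det_fin_two_of, cubic]
    ring
  · have hab' : (C b ^ 2 : PolyRing k) = C a ^ 3 + C a ^ 2 := by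
      simp only [← map_pow, ← map_add, hab]
    simp only [hphi, phiAff, Matrix.det_fin_two_of, cubic, map_add, map_pow, map_one]
    linear_combination X 2 ^ 3 * hab'

lemma phi_apply_mem_polyDeg (hp : p ∈ curve k) (i j : Fin 2) :
    phi p i j ∈ polyDeg k (![1, 2] j) := by
  obtain ⟨-, -, -, hphi⟩ | ⟨a, b, -, -, -, -, hphi⟩ := phi_eq_phiInf_or_phiAff hp
  · rw [hphi]
    fin_cases i <;> fin_cases j
    · exact add_mem (X_mem_polyDeg 0) (X_mem_polyDeg 2)
    · exact X_sq_mem_polyDeg 1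
    · exact X_mem_polyDeg 2
    · exact X_sq_mem_polyDeg 0
  · rw [hphi]
    fin_cases i <;> fin_cases j
    · exact sub_mem (X_mem_polyDeg 0) (C_mul_mem_polyDeg _ (X_mem_polyDeg 2))
    · exact add_mem (X_mul_X_mem_polyDeg 1 2) (C_mul_mem_polyDeg _ (X_sq_mem_polyDeg 2))
    · exact sub_mem (X_mem_polyDeg 1) (C_mul_mem_polyDeg _ (X_mem_polyDeg 2))
    · refine add_mem (add_mem (X_sq_mem_polyDeg 0) ?_) (C_mul_mem_polyDeg _ (X_sq_mem_polyDeg 2))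
      change _ * _ * _ ∈ _
      rw [mul_assoc]
      exact C_mul_mem_polyDeg _ (X_mul_X_mem_polyDeg 0 2)

end Points

section Factorizations

variable {k : Type u} [Field k] {n : ℕ}

lemma mem_polyDeg_of_mul_mem {d e : ℤ} {s t : PolyRing k} (ht : t ∈ polyDeg k d) (ht0 : t ≠ 0)
    (hst : s * t ∈ polyDeg k e) : s ∈ polyDeg k (e - d) := by
  have hcomp := homogComp_self hst
  rw [homogComp_mul ht] at hcomp
  exact mul_right_cancel₀ ht0 hcomp ▸ homogComp_mem _ _

lemma not_cubic_dvd_of_mem_polyDeg {d : ℤ} (hd : d < 3) {s : PolyRing k} (hs : s ∈ polyDeg k d)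
    (hs0 : s ≠ 0) : ¬ cubic k ∣ s := by
  rintro ⟨t, rfl⟩
  rw [mul_comm] at hs hs0
  have ht := mem_polyDeg_of_mul_mem (cubic_mem_polyDeg k) (cubic_ne_zero k) hs
  rw [mem_polyDeg_of_neg (by omega)] at ht
  exact hs0 (by rw [ht, zero_mul])

lemma IsHomogeneousMatrix.mul {a b c : Fin n → ℤ} {A B : Matrix (Fin n) (Fin n) (PolyRing k)}
    (hA : IsHomogeneousMatrix a b A) (hB : IsHomogeneousMatrix b c B) :
    IsHomogeneousMatrix a c (A * B) := fun i j => by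
  rw [Matrix.mul_apply]
  refine sum_mem fun l _ => ?_
  convert mul_mem_polyDeg (hA i l) (hB l j) using 2
  ring

lemma isHomogeneousMatrix_map_C (c : ℤ) (P : Matrix (Fin 2) (Fin 2) k) :
    IsHomogeneousMatrix ![c, c] ![c, c] (P.map C) := fun i j => by
  fin_cases i <;> fin_cases j <;> simpa using C_mem_polyDeg _

lemma IsHomogeneousMatrix.adjugate {a b : Fin 2 → ℤ} {A : Matrix (Fin 2) (Fin 2) (PolyRing k)}
    (hA : IsHomogeneousMatrix a b A) :
    IsHomogeneousMatrix b (fun j => a j + (b 0 + b 1 - a 0 - a 1)) A.adjugate := by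
  simp only [IsHomogeneousMatrix, Fin.forall_fin_two, Matrix.adjugate_fin_two, Matrix.of_apply,
    Matrix.cons_val]
  refine ⟨⟨?_, ?_⟩, ?_, ?_⟩
  · convert hA 1 1 using 2
    ring
  · convert neg_mem (hA 0 1) using 2
    ring
  · convert neg_mem (hA 1 0) using 2
    ring
  · convert hA 0 0 using 2
    ring

lemma isHomogeneousMatrix_phi {p : ℙ k (Fin 3 → k)} (hp : p ∈ curve k) (c : ℤ) :
    IsHomogeneousMatrix ![c, c] ![c + 1, c + 2] (phi p) := fun i j => by
  convert phi_apply_mem_polyDeg hp i j using 2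
  fin_cases i <;> fin_cases j <;> simp

lemma constantCoeff_phi {p : ℙ k (Fin 3 → k)} (hp : p ∈ curve k) (i j : Fin 2) :
    constantCoeff (phi p i j) = 0 :=
  constantCoeff_eq_zero_of_mem (by fin_cases j <;> decide) (phi_apply_mem_polyDeg hp i j)

lemma phi_apply_ne_zero {p : ℙ k (Fin 3 → k)} (hp : p ∈ curve k) (i j : Fin 2) :
    phi p i j ≠ 0 :=
  entry_ne_zero_of_irreducible_det (det_phi hp ▸ cubic_irreducible k)
    (fun i j => not_isUnit_of_constantCoeff_eq_zero (constantCoeff_phi hp i j)) i j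

lemma exists_eq_mul_of_col_zero_eq {S : Type*} [CommRing S] [IsDomain S]
    {A B : Matrix (Fin 2) (Fin 2) S} {c : S} (hA : Prime A.det) (hdvd : ¬ A.det ∣ A 1 0)
    (hB : B.det = c * A.det) (hcol : ∀ i, B i 0 = A i 0) : ∃ t, B = A * !![1, t; 0, c] := by
  rw [Matrix.det_fin_two B, hcol, hcol, Matrix.det_fin_two A] at hB
  rw [Matrix.det_fin_two A] at hA hdvd
  have hmul : A 1 0 * (A 1 1 * B 0 1 - A 0 1 * B 1 1) =
      (A 0 0 * A 1 1 - A 0 1 * A 1 0) * (B 1 1 - A 1 1 * c) := by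
    linear_combination -A 1 1 * hB
  obtain ⟨t, ht⟩ := (hA.dvd_or_dvd ⟨_, hmul⟩).resolve_left hdvd
  have h1 : B 1 1 = A 1 0 * t + A 1 1 * c := by
    refine mul_left_cancel₀ hA.ne_zero ?_
    linear_combination A 1 0 * ht - hmul
  have h0 : B 0 1 = A 0 0 * t + A 0 1 * c := by
    refine mul_left_cancel₀ hA.ne_zero ?_
    linear_combination A 0 0 * ht + A 0 1 * hB
  refine ⟨t, Matrix.ext fun i j => ?_⟩
  fin_cases i <;> fin_cases j <;> simp [Matrix.mul_apply, hcol, h0, h1]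

variable {A : Matrix (Fin 2) (Fin 2) (PolyRing k)} {c : ℤ}

lemma exists_mem_curve_eval_rep_col_zero (hA : ∀ i, A i 0 ∈ polyDeg k 1)
    (hdet : Associated A.det (cubic k)) : ∃ p ∈ curve k, ∀ i, eval p.rep (A i 0) = 0 := by
  choose e he using fun i => exists_linear_of_mem_polyDeg_one (hA i)
  have hker : LinearMap.ker (Matrix.of e).mulVecLin ≠ ⊥ :=
    LinearMap.ker_ne_bot_of_finrank_lt (by simp)
  obtain ⟨v, hv, hv0⟩ := Submodule.exists_mem_ne_zero_of_ne_bot hker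
  obtain ⟨a, ha⟩ := Projectivization.exists_smul_eq_mk_rep k v hv0
  have heval (i : Fin 2) : eval (Projectivization.mk k v hv0).rep (A i 0) = 0 := by
    have hvi : ∑ j, e i j * v j = 0 := congrFun hv i
    rw [← ha, he]
    simp only [map_sum, map_mul, eval_C, eval_X, Pi.smul_apply, Units.smul_def, smul_eq_mul,
      mul_left_comm _ (a : k), ← Finset.mul_sum, hvi, mul_zero]
  refine ⟨_, ?_, heval⟩
  obtain ⟨b, hb, hdetb⟩ := exists_eq_C_mul_cubic_of_associated hdet
  have hdet0 := congrArg (eval (Projectivization.mk k v hv0).rep) hdetb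
  rw [Matrix.det_fin_two, map_sub, map_mul, map_mul, map_mul, heval, heval, eval_C, zero_mul,
    mul_zero, sub_zero] at hdet0
  exact (mul_eq_zero.1 hdet0.symm).resolve_left hb

lemma exists_col_zero_eq (hA : ∀ i, A i 0 ∈ polyDeg k 1)
    (hcoeff : ∀ i j, constantCoeff (A i j) = 0)
    (hdet : Associated A.det (cubic k)) :
    ∃ p ∈ curve k, ∃ P : Matrix (Fin 2) (Fin 2) k,
      IsUnit P.det ∧ ∀ i, A i 0 = (P.map (C : k →+* PolyRing k) * phi p) i 0 := by
  obtain ⟨p, hp, heval⟩ := exists_mem_curve_eval_rep_col_zero hA hdet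
  choose w hw using fun i => exists_eq_of_eval_rep_eq_zero hp (hA i) (heval i)
  refine ⟨p, hp, Matrix.of w, ?_, hw⟩
  rw [isUnit_iff_ne_zero]
  intro hdet0
  obtain ⟨v, hv0, hv⟩ := Matrix.exists_vecMul_eq_zero_iff.2 hdet0
  refine hv0 (eq_zero_of_sum_C_mul_col_eq_zero (hdet.symm.irreducible (cubic_irreducible k))
    hcoeff ?_)
  have hv' (j : Fin 2) : ∑ i, v i * w i j = 0 := congrFun hv j
  simp only [hw, Finset.mul_sum]
  rw [Finset.sum_comm]
  simp only [← mul_assoc, ← Finset.sum_mul, ← map_mul, ← map_sum, hv', map_zero, zero_mul,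
    Finset.sum_const_zero]

lemma exists_eq_phi_mul {p : ℙ k (Fin 3 → k)} (hp : p ∈ curve k)
    (hA : IsHomogeneousMatrix ![c, c] ![c + 1, c + 2] A) (hdet : Associated A.det (cubic k))
    (hcol : ∀ i, A i 0 = phi p i 0) :
    ∃ t ∈ polyDeg k 1, ∃ e : k, e ≠ 0 ∧ A = phi p * !![1, t; 0, C e] := by
  obtain ⟨e, he, hAe⟩ := exists_eq_C_mul_cubic_of_associated hdet
  have hdvd : ¬ cubic k ∣ phi p 1 0 :=
    not_cubic_dvd_of_mem_polyDeg (by simp) (phi_apply_mem_polyDeg hp 1 0) (phi_apply_ne_zero hp 1 0)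
  rw [← det_phi hp] at hAe hdvd
  obtain ⟨t, rfl⟩ := exists_eq_mul_of_col_zero_eq (det_phi hp ▸ cubic_prime k) hdvd hAe hcol
  refine ⟨t, ?_, e, he, rfl⟩
  have hmem : (phi p * !![1, t; 0, C e]) 0 1 - C e * phi p 0 1 ∈ polyDeg k 2 := by
    refine sub_mem ?_ (C_mul_mem_polyDeg e (phi_apply_mem_polyDeg hp 0 1))
    simpa using hA 0 1
  have hsub : (phi p * !![1, t; 0, C e]) 0 1 - C e * phi p 0 1 = t * phi p 0 0 := by
    simp only [Matrix.mul_apply, Fin.sum_univ_two, Matrix.of_apply, Matrix.cons_val]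
    ring
  exact mem_polyDeg_of_mul_mem (phi_apply_mem_polyDeg hp 0 0) (phi_apply_ne_zero hp 0 0)
    (hsub ▸ hmem)

lemma isUnit_det_map_C {P : Matrix (Fin n) (Fin n) k} (hP : IsUnit P.det) :
    IsUnit (P.map (C : k →+* PolyRing k)).det := by
  rw [← RingHom.mapMatrix_apply, ← RingHom.map_det]
  exact hP.map C

lemma exists_eq_mul_phi_mul (hA : IsHomogeneousMatrix ![c, c] ![c + 1, c + 2] A)
    (hdet : Associated A.det (cubic k)) :
    ∃ p ∈ curve k, ∃ (P : Matrix (Fin 2) (Fin 2) k) (t : PolyRing k) (e : k),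
      IsUnit P.det ∧ t ∈ polyDeg k 1 ∧ e ≠ 0 ∧ A = P.map C * phi p * !![1, t; 0, C e] := by
  have hA1 (i) : A i 0 ∈ polyDeg k 1 := by
    convert hA i 0 using 2
    fin_cases i <;> simp
  have hcoeff (i j) : constantCoeff (A i j) = 0 :=
    constantCoeff_eq_zero_of_mem (by fin_cases i <;> fin_cases j <;> simp) (hA i j)
  obtain ⟨p, hp, P, hP, hcol⟩ := exists_col_zero_eq hA1 hcoeff hdet
  have hP' : IsUnit P⁻¹.det := P.isUnit_nonsing_inv_det hP
  set U : Matrix (Fin 2) (Fin 2) (PolyRing k) := P.map C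
  let V : Matrix (Fin 2) (Fin 2) (PolyRing k) := P⁻¹.map C
  have hUV : U * V = 1 := by
    rw [← Matrix.map_mul, P.mul_nonsing_inv hP, Matrix.map_one _ (map_zero C) (map_one C)]
  have hVcol (i : Fin 2) : (V * A) i 0 = phi p i 0 := by
    have : (V * A) i 0 = (V * (U * phi p)) i 0 := by
      simp only [Matrix.mul_apply (M := V), hcol]
    rw [this, ← mul_assoc, mul_eq_one_comm.1 hUV, one_mul]
  have hVdet : Associated (V * A).det (cubic k) := by
    rw [Matrix.det_mul]
    exact (associated_unit_mul_left _ _ (isUnit_det_map_C hP')).trans hdet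
  obtain ⟨t, ht, e, he, hVA⟩ :=
    exists_eq_phi_mul hp ((isHomogeneousMatrix_map_C c P⁻¹).mul hA) hVdet hVcol
  exact ⟨p, hp, P, t, e, hP, ht, he, by rw [mul_assoc, ← hVA, ← mul_assoc, hUV, one_mul]⟩

lemma exists_eq_mul_psi_mul (hA : IsHomogeneousMatrix ![c, c + 1] ![c + 2, c + 2] A)
    (hdet : Associated A.det (cubic k)) :
    ∃ p ∈ curve k, ∃ P Q : Matrix (Fin 2) (Fin 2) (PolyRing k),
      IsUnit P.det ∧ IsUnit Q.det ∧ IsHomogeneousMatrix ![c, c + 1] ![c, c + 1] P ∧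
        A = P * psi p * Q := by
  have hadj : IsHomogeneousMatrix ![c + 2, c + 2] ![c + 2 + 1, c + 2 + 2] A.adjugate :=
    fun i j => by
      convert hA.adjugate i j using 2
      fin_cases j <;> simp <;> ring
  obtain ⟨p, hp, P, t, e, hP, ht, he, hadj⟩ := exists_eq_mul_phi_mul hadj
    (by rwa [Matrix.det_adjugate, Fintype.card_fin, pow_one])
  refine ⟨p, hp, Matrix.adjugate !![1, t; 0, C e], (P.map C).adjugate, ?_, ?_, ?_, ?_⟩
  · rw [Matrix.det_adjugate, Matrix.det_fin_two_of]
    simpa using he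
  · rw [Matrix.det_adjugate]
    exact (isUnit_det_map_C hP).pow _
  · intro i j
    rw [Matrix.adjugate_fin_two_of]
    fin_cases i <;> fin_cases j
    · simpa using C_mem_polyDeg e
    · simpa using ht
    · simp
    · simpa using C_mem_polyDeg (1 : k)
  · rw [psi_eq_adjugate, mul_assoc, ← Matrix.adjugate_mul_distrib, ← Matrix.adjugate_mul_distrib,
      ← hadj, Matrix.adjugate_adjugate _ (by simp)]
    simp

end Factorizations

section Classification

variable {k : Type u} [Field k] {M : Type v} [AddCommGroup M] [Module (NodeRing k) M]
  {gr : ℤ → AddSubgroup M}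

theorem IsGradedMCM.exists_gradedIso_coker (h : IsGradedMCM (k := k) gr)
    (h2 : (⊤ : Submodule (NodeRing k) M).spanFinrank = 2)
    (hfree : ¬ Module.Free (NodeRing k) M) :
    ∃ p ∈ curve k, ∃ d, GradedIso k gr (cokerPhiDeg p) d ∨ GradedIso k gr (cokerPsiDeg p) d := by
  obtain ⟨g, a, b, A, hpres, hA, hcoeff⟩ := h.exists_isPresentation h2
  obtain ⟨σ, τ, c, hab⟩ :=
    degrees_of_associated_det_cubic hA (hpres.associated_det_cubic hfree hcoeff) hcoeff
  have hdet := (hpres.submatrix σ τ).associated_det_cubic hfree fun i j => hcoeff (σ i) (τ j)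
  have hA' : IsHomogeneousMatrix (a ∘ σ) (b ∘ τ) (A.submatrix σ τ) := fun i j => hA (σ i) (τ j)
  have hpres' := hpres.submatrix σ τ
  obtain ⟨ha, hb⟩ | ⟨ha, hb⟩ := hab <;> rw [ha, hb] at hA' <;> rw [ha] at hpres'
  · obtain ⟨p, hp, P, t, e, hP, ht, he, hfac⟩ := exists_eq_mul_phi_mul hA' hdet
    rw [hfac] at hpres'
    have hphi := hpres'.of_mul h.isGrading (isUnit_det_map_C hP) (by simpa using he)
      (isHomogeneousMatrix_map_C c P)
    exact ⟨p, hp, 1 - c, .inl (hphi.gradedIso h.isGrading fun i => by fin_cases i <;> simp)⟩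
  · obtain ⟨p, hp, P, Q, hP, hQ, hPdeg, hfac⟩ := exists_eq_mul_psi_mul hA' hdet
    rw [hfac] at hpres'
    have hpsi := hpres'.of_mul h.isGrading hP hQ hPdeg
    exact ⟨p, hp, -c, .inr (hpsi.gradedIso h.isGrading fun i => by fin_cases i <;> simp)⟩

end Classification

section Cokernels

variable {k : Type u} [Field k] {n : ℕ} {A B P Q : Matrix (Fin n) (Fin n) (PolyRing k)}

lemma matMap_mul (A B : Matrix (Fin n) (Fin n) (PolyRing k)) :
    matMap (A * B) = matMap A ∘ₗ matMap B := by
  rw [matMap, Matrix.map_mul, Matrix.mulVecLin_mul]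
  rfl

lemma matMap_apply (A : Matrix (Fin n) (Fin n) (PolyRing k)) (v : Fin n → NodeRing k) (i : Fin n) :
    matMap A v i = ∑ j, π (A i j) * v j :=
  rfl

lemma ker_matMap (hAB : A * B = cubic k • (1 : Matrix (Fin n) (Fin n) (PolyRing k)))
    (hBA : B * A = cubic k • (1 : Matrix (Fin n) (Fin n) (PolyRing k))) :
    LinearMap.ker (matMap A) = LinearMap.range (matMap B) := by
  apply le_antisymm
  · intro v hv
    obtain ⟨v, rfl⟩ := Ideal.Quotient.mk_surjective.comp_left v
    rw [LinearMap.mem_ker, matMap_comp_mk] at hv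
    choose w hw using fun i => mk_eq_zero_iff.1 (congrFun hv i)
    have hAv : A *ᵥ v = cubic k • w := funext hw
    have hv' : cubic k • v = cubic k • B *ᵥ w := by
      rw [← Matrix.mulVec_smul, ← hAv, Matrix.mulVec_mulVec, hBA, Matrix.smul_mulVec,
        Matrix.one_mulVec]
    exact ⟨π ∘ w, by rw [matMap_comp_mk, smul_right_injective _ (cubic_ne_zero k) hv']⟩
  · rintro _ ⟨w, rfl⟩
    obtain ⟨w, rfl⟩ := Ideal.Quotient.mk_surjective.comp_left w
    rw [LinearMap.mem_ker, ← LinearMap.comp_apply, ← matMap_mul, hAB, matMap_comp_mk,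
      Matrix.smul_mulVec, Matrix.one_mulVec]
    exact funext fun i => mk_eq_zero_iff.2 ⟨w i, rfl⟩

/-- The isomorphism `Coker B ≃ im A` induced by `A` when `ker A = im B`. -/
def cokerEquivRange (h : LinearMap.ker (matMap A) = LinearMap.range (matMap B)) :
    Coker B ≃ₗ[NodeRing k] LinearMap.range (matMap A) :=
  Submodule.quotEquivOfEq _ _ h.symm ≪≫ₗ (matMap A).quotKerEquivRange

lemma finrank_coker_add_finrank_coker
    (h : LinearMap.ker (matMap A) = LinearMap.range (matMap B)) :
    Module.finrank (NodeRing k) (Coker A) + Module.finrank (NodeRing k) (Coker B) = n := by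
  rw [(cokerEquivRange h).finrank_eq]
  simpa using Submodule.finrank_quotient_add_finrank (LinearMap.range (matMap A))

lemma finrank_coker_pos (h : LinearMap.ker (matMap A) = LinearMap.range (matMap B)) {i j : Fin n}
    (hA : ¬ cubic k ∣ A i j) : 0 < Module.finrank (NodeRing k) (Coker B) := by
  have hne : LinearMap.range (matMap A) ≠ ⊥ := fun h0 => hA <| by
    have hcol : matMap A (π ∘ Pi.single j 1) = 0 := by
      rw [LinearMap.range_eq_bot.1 h0, LinearMap.zero_apply]
    rw [matMap_comp_mk, Matrix.mulVec_single_one] at hcol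
    exact mk_eq_zero_iff.1 (congrFun hcol i)
  have := Submodule.nontrivial_iff_ne_bot.2 hne
  rw [(cokerEquivRange h).finrank_eq]
  exact Module.finrank_pos

lemma range_matMap_mul (h : P * Q = 1) :
    LinearMap.range (matMap (A * P)) = LinearMap.range (matMap A) := by
  apply le_antisymm
  · rw [matMap_mul]
    exact LinearMap.range_comp_le_range _ _
  · conv_lhs => rw [← mul_one A, ← h, ← mul_assoc, matMap_mul]
    exact LinearMap.range_comp_le_range _ _

lemma ker_matMap_mul (h : Q * P = 1) :
    LinearMap.ker (matMap (P * A)) = LinearMap.ker (matMap A) := by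
  apply le_antisymm
  · conv_rhs => rw [← one_mul A, ← h, mul_assoc, matMap_mul]
    exact LinearMap.ker_le_ker_comp _ _
  · rw [matMap_mul]
    exact LinearMap.ker_le_ker_comp _ _

end Cokernels

section GradedCokernels

variable {k : Type u} [Field k] {n : ℕ} {a b : Fin n → ℤ} {d : ℤ}
  {A B C D : Matrix (Fin n) (Fin n) (PolyRing k)}

lemma gradedIso_of_mem_iff {M : Type v} [AddCommGroup M] [Module (NodeRing k) M] {N : Type w}
    [AddCommGroup N] [Module (NodeRing k) N] {grM : ℤ → AddSubgroup M} {grN : ℤ → AddSubgroup N}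
    (e : M ≃ₗ[NodeRing k] N) (h : ∀ j x, e x ∈ grN (j + d) ↔ x ∈ grM j) :
    GradedIso k grM grN d := by
  refine ⟨e, fun j => AddSubgroup.ext fun y => ⟨?_, fun hy => ?_⟩⟩
  · rintro ⟨x, hx, rfl⟩
    exact (h j x).2 hx
  · exact ⟨e.symm y, (h j _).1 (by rwa [e.apply_symm_apply]), e.apply_symm_apply y⟩

lemma mem_freeDeg {j : ℤ} {v : Fin n → NodeRing k} :
    v ∈ freeDeg k a j ↔ ∀ i, v i ∈ ringDeg k (j - a i) := by
  simp [freeDeg, AddSubgroup.mem_pi]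

lemma mul_mem_ringDeg {d e : ℤ} {r s : NodeRing k} (hr : r ∈ ringDeg k d) (hs : s ∈ ringDeg k e) :
    r * s ∈ ringDeg k (d + e) := by
  obtain ⟨x, hx, rfl⟩ := hr
  obtain ⟨y, hy, rfl⟩ := hs
  exact ⟨x * y, mul_mem_polyDeg hx hy, map_mul π x y⟩

lemma IsHomogeneousMatrix.matMap_mem (hA : IsHomogeneousMatrix a b A) {j : ℤ}
    {v : Fin n → NodeRing k} (hv : v ∈ freeDeg k b j) : matMap A v ∈ freeDeg k a j := by
  rw [mem_freeDeg] at hv ⊢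
  intro i
  rw [matMap_apply]
  refine sum_mem fun l _ => ?_
  convert mul_mem_ringDeg (mk_mem_ringDeg (hA i l)) (hv l) using 2
  ring

lemma IsHomogeneousMatrix.homogComp_mulVec (hA : IsHomogeneousMatrix a b A) (j : ℤ)
    (v : Fin n → PolyRing k) (i : Fin n) :
    homogComp (j - a i) ((A *ᵥ v) i) = (A *ᵥ fun l => homogComp (j - b l) (v l)) i := by
  simp only [Matrix.mulVec, dotProduct, map_sum, mul_comm (A i _)]
  refine Finset.sum_congr rfl fun l _ => ?_
  rw [homogComp_mul (hA i l), sub_sub_sub_cancel_right]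

lemma mk_homogComp_of_mem {j : ℤ} {s : PolyRing k} (hs : π s ∈ ringDeg k j) :
    π (homogComp j s) = π s := by
  obtain ⟨t, ht, hts : π t = π s⟩ := hs
  obtain ⟨q, hq⟩ : cubic k ∣ s - t := by rw [← mk_eq_zero_iff, map_sub, hts, sub_self]
  have hcomp := congrArg (homogComp j) hq
  rw [map_sub, homogComp_self ht, mul_comm, homogComp_mul (cubic_mem_polyDeg k)] at hcomp
  rw [← hts, ← sub_eq_zero, ← map_sub, hcomp, mk_eq_zero_iff]
  exact dvd_mul_left _ _

lemma IsHomogeneousMatrix.exists_homogeneous_preimage (hA : IsHomogeneousMatrix a b A) {j : ℤ}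
    {v : Fin n → NodeRing k} (hv : matMap A v ∈ freeDeg k a j) :
    ∃ w ∈ freeDeg k b j, matMap A w = matMap A v := by
  obtain ⟨v, rfl⟩ := Ideal.Quotient.mk_surjective.comp_left v
  rw [matMap_comp_mk, mem_freeDeg] at hv
  refine ⟨π ∘ fun l => homogComp (j - b l) (v l),
    mem_freeDeg.2 fun l => mk_mem_ringDeg (homogComp_mem _ _), ?_⟩
  rw [matMap_comp_mk, matMap_comp_mk]
  ext1 i
  rw [Function.comp_apply, ← hA.homogComp_mulVec, mk_homogComp_of_mem (hv i), Function.comp_apply]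

lemma IsHomogeneousMatrix.mkQ_mem_cokerDeg_iff
    (hA : IsHomogeneousMatrix a (fun i => b i + d) A)
    (hker : LinearMap.ker (matMap A) = LinearMap.range (matMap B)) {j : ℤ}
    {v : Fin n → NodeRing k} :
    Submodule.mkQ _ v ∈ cokerDeg B b j ↔ matMap A v ∈ freeDeg k a (j + d) := by
  have hdeg : freeDeg k b j = freeDeg k (fun i => b i + d) (j + d) := by
    simp only [freeDeg, add_sub_add_right_eq_sub]
  constructor
  · rintro ⟨w, hw, hwv⟩
    have hsub : w - v ∈ LinearMap.range (matMap B) := (Submodule.Quotient.eq _).1 hwv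
    rw [← hker, LinearMap.mem_ker, map_sub, sub_eq_zero] at hsub
    exact hsub ▸ hA.matMap_mem (hdeg ▸ hw)
  · intro hv
    obtain ⟨w, hw, hwv⟩ := hA.exists_homogeneous_preimage hv
    refine ⟨w, hdeg ▸ hw, (Submodule.Quotient.eq _).2 ?_⟩
    rw [← hker, LinearMap.mem_ker, map_sub, hwv, sub_self]

lemma mem_smul_top_of_forall_mem {S : Type v} [CommRing S] {I : Ideal S} {v : Fin n → S}
    (h : ∀ i, v i ∈ I) : v ∈ I • (⊤ : Submodule S (Fin n → S)) := by
  rw [pi_eq_sum_univ' v]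
  exact Submodule.sum_mem _ fun i _ => Submodule.smul_mem_smul (h i) trivial

theorem isFirstSyzygy_coker (hcoeff : ∀ i j, constantCoeff (A i j) = 0)
    (hA : IsHomogeneousMatrix a (fun i => b i + d) A)
    (hker : LinearMap.ker (matMap A) = LinearMap.range (matMap B)) :
    IsFirstSyzygy k (cokerDeg B b) (cokerDeg A a) d := by
  refine ⟨n, a, (LinearMap.range (matMap A)).mkQ, Submodule.mkQ_surjective _,
    fun j x hx => ⟨x, hx, rfl⟩, ?_, ?_⟩
  · rw [Submodule.ker_mkQ]
    rintro _ ⟨v, rfl⟩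
    refine mem_smul_top_of_forall_mem fun i => ?_
    rw [matMap_apply]
    exact sum_mem fun l _ => Ideal.mul_mem_right _ _ (mk_mem_irrelevant (hcoeff i l))
  · refine gradedIso_of_mem_iff
      (cokerEquivRange hker ≪≫ₗ LinearEquiv.ofEq _ _ (Submodule.ker_mkQ _).symm) fun j x => ?_
    obtain ⟨v, rfl⟩ := Submodule.mkQ_surjective _ x
    exact (hA.mkQ_mem_cokerDeg_iff hker).symm

lemma comap_piEquiv_dualAnnihilator_range (A : Matrix (Fin n) (Fin n) (PolyRing k)) :
    (LinearMap.range (matMap A)).dualAnnihilator.comap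
        (Module.piEquiv (Fin n) (NodeRing k) (NodeRing k)).toLinearMap =
      LinearMap.ker (matMap Aᵀ) := by
  ext x
  have hx (w : Fin n → NodeRing k) :
      Module.piEquiv (Fin n) (NodeRing k) (NodeRing k) x (matMap A w) = matMap Aᵀ x ⬝ᵥ w := by
    rw [Module.piEquiv_apply_apply, matMap, matMap, Matrix.transpose_map, Matrix.mulVecLin_apply,
      Matrix.mulVecLin_apply, Matrix.mulVec_transpose, ← Matrix.dotProduct_mulVec]
    exact dotProduct_comm _ _
  simp only [Submodule.mem_comap, Submodule.mem_dualAnnihilator, LinearMap.mem_range,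
    forall_exists_index, forall_apply_eq_imp_iff, LinearEquiv.coe_coe, hx, LinearMap.mem_ker,
    dotProduct_eq_zero_iff]

/-- The identification of `Hom_R(Coker A, R)` with `ker Aᵀ` by the values on the generators. -/
def kerTransposeEquivDual (A : Matrix (Fin n) (Fin n) (PolyRing k)) :
    LinearMap.ker (matMap Aᵀ) ≃ₗ[NodeRing k] Module.Dual (NodeRing k) (Coker A) :=
  LinearEquiv.ofEq _ _ (comap_piEquiv_dualAnnihilator_range A).symm ≪≫ₗ
    (Module.piEquiv (Fin n) (NodeRing k) (NodeRing k)).ofSubmodule' _ ≪≫ₗ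
      (Submodule.dualQuotEquivDualAnnihilator _).symm

lemma kerTransposeEquivDual_mkQ (x : LinearMap.ker (matMap Aᵀ)) (v : Fin n → NodeRing k) :
    kerTransposeEquivDual A x (Submodule.mkQ _ v) = ∑ i, v i * (x : Fin n → NodeRing k) i :=
  Module.piEquiv_apply_apply _ _ _ _ _

lemma kerTransposeEquivDual_mem_dualDeg_iff {j : ℤ} (x : LinearMap.ker (matMap Aᵀ)) :
    kerTransposeEquivDual A x ∈ dualDeg k (cokerDeg A a) j ↔
      (x : Fin n → NodeRing k) ∈ freeDeg k (-a) j := by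
  simp only [mem_freeDeg, Pi.neg_apply, sub_neg_eq_add]
  constructor
  · intro hx i
    have hmem : Pi.single i 1 ∈ freeDeg k a (a i) := mem_freeDeg.2 fun l => by
      obtain rfl | hl := eq_or_ne l i
      · rw [Pi.single_eq_same, sub_self]
        exact mk_mem_ringDeg (C_mem_polyDeg 1)
      · rw [Pi.single_eq_of_ne hl]
        exact zero_mem _
    have := hx (a i) _ ⟨_, hmem, rfl⟩
    rw [LinearMap.toAddMonoidHom_coe, kerTransposeEquivDual_mkQ] at this
    simpa [Pi.single_apply, add_comm] using this
  · rintro hx l _ ⟨v, hv, rfl⟩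
    rw [LinearMap.toAddMonoidHom_coe, kerTransposeEquivDual_mkQ]
    refine sum_mem fun i _ => ?_
    convert mul_mem_ringDeg (mem_freeDeg.1 hv i) (hx i) using 2
    ring

theorem gradedIso_coker_dual (hker : LinearMap.ker (matMap C) = LinearMap.range (matMap D))
    (hrange : LinearMap.range (matMap C) = LinearMap.ker (matMap Aᵀ))
    (hC : IsHomogeneousMatrix (-a) (fun i => b i + d) C) :
    GradedIso k (cokerDeg D b) (dualDeg k (cokerDeg A a)) d := by
  refine gradedIso_of_mem_iff (cokerEquivRange hker ≪≫ₗ LinearEquiv.ofEq _ _ hrange ≪≫ₗ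
    kerTransposeEquivDual A) fun j x => ?_
  obtain ⟨v, rfl⟩ := Submodule.mkQ_surjective _ x
  exact (kerTransposeEquivDual_mem_dualDeg_iff _).trans (hC.mkQ_mem_cokerDeg_iff hker).symm

end GradedCokernels

section CurveCokernels

variable {k : Type u} [Field k] {p : ℙ k (Fin 3 → k)}

theorem isGradedMatrixFactorization (hp : p ∈ curve k) :
    IsGradedMatrixFactorization (cubic k) 3 ![1, 1] ![2, 3] (phi p) (psi p) where
  mul_eq := by rw [psi_eq_adjugate, Matrix.mul_adjugate, det_phi hp]
  mul_eq' := by rw [psi_eq_adjugate, Matrix.adjugate_mul, det_phi hp]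
  left_mem := isHomogeneousMatrix_phi hp 1
  right_mem := psi_eq_adjugate p ▸ (isHomogeneousMatrix_phi hp 1).adjugate

lemma ker_matMap_phi (hp : p ∈ curve k) :
    LinearMap.ker (matMap (phi p)) = LinearMap.range (matMap (psi p)) :=
  ker_matMap (isGradedMatrixFactorization hp).mul_eq (isGradedMatrixFactorization hp).mul_eq'

lemma ker_matMap_psi (hp : p ∈ curve k) :
    LinearMap.ker (matMap (psi p)) = LinearMap.range (matMap (phi p)) :=
  ker_matMap (isGradedMatrixFactorization hp).mul_eq' (isGradedMatrixFactorization hp).mul_eq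

theorem rank_coker_phi_psi (hp : p ∈ curve k) :
    Module.rank (NodeRing k) (Coker (phi p)) = 1 ∧
      Module.rank (NodeRing k) (Coker (psi p)) = 1 := by
  have hphi : ¬ cubic k ∣ phi p 0 0 :=
    not_cubic_dvd_of_mem_polyDeg (by simp) (phi_apply_mem_polyDeg hp 0 0) (phi_apply_ne_zero hp 0 0)
  have hpsi : ¬ cubic k ∣ psi p 1 1 := by
    rwa [psi_eq_adjugate, Matrix.adjugate_fin_two]
  have hpos := finrank_coker_pos (ker_matMap_phi hp) hphi
  have hpos' := finrank_coker_pos (ker_matMap_psi hp) hpsi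
  have hsum := finrank_coker_add_finrank_coker (ker_matMap_phi hp)
  simp only [Module.rank_eq_one_iff_finrank_eq_one]
  omega

theorem isFirstSyzygy_coker_psi (hp : p ∈ curve k) :
    IsFirstSyzygy k (cokerPsiDeg p) (cokerPhiDeg p) 2 :=
  isFirstSyzygy_coker (constantCoeff_phi hp)
    (fun i j => by convert isHomogeneousMatrix_phi hp 1 i j using 2; fin_cases j <;> rfl)
    (ker_matMap_phi hp)

variable (k) in
/-- The matrix of the quarter turn, which conjugates the adjugate of a `2 × 2` matrix into its
transpose. -/
def quarterTurn : Matrix (Fin 2) (Fin 2) (PolyRing k) :=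
  !![0, -1; 1, 0]

lemma quarterTurn_mul_transpose : quarterTurn k * (quarterTurn k)ᵀ = 1 := by
  ext1 i j
  fin_cases i <;> fin_cases j <;> simp [quarterTurn, Matrix.mul_apply]

lemma transpose_adjugate_eq (A : Matrix (Fin 2) (Fin 2) (PolyRing k)) :
    A.adjugateᵀ = quarterTurn k * A * (quarterTurn k)ᵀ := by
  ext1 i j
  fin_cases i <;> fin_cases j <;>
    simp [quarterTurn, Matrix.mul_apply, Matrix.adjugate_fin_two, Matrix.vecMul, dotProduct]

theorem gradedIso_coker_psi_dual (hp : p ∈ curve k) :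
    GradedIso k (cokerPsiDeg p) (dualDeg k (cokerPhiDeg p)) 0 := by
  have hF := isGradedMatrixFactorization hp
  refine gradedIso_coker_dual (C := quarterTurn k * phi p) ?_ ?_ ?_
  · rw [ker_matMap_mul (mul_eq_one_comm.1 quarterTurn_mul_transpose), ker_matMap_phi hp]
  · rw [← range_matMap_mul (mul_eq_one_comm.1 quarterTurn_mul_transpose), ← transpose_adjugate_eq,
      ← psi_eq_adjugate]
    refine (ker_matMap ?_ ?_).symm
    · rw [← Matrix.transpose_mul, hF.mul_eq', Matrix.transpose_smul, Matrix.transpose_one]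
    · rw [← Matrix.transpose_mul, hF.mul_eq, Matrix.transpose_smul, Matrix.transpose_one]
  · intro i j
    have h0 := phi_apply_mem_polyDeg hp 0 j
    have h1 := phi_apply_mem_polyDeg hp 1 j
    fin_cases i <;> fin_cases j <;> simpa [quarterTurn, Matrix.mul_apply]

end CurveCokernels

section CokerEquiv

variable {S : Type u} [CommRing S] {n : ℕ} {A B T : Matrix (Fin n) (Fin n) S}

lemma exists_eq_mul_of_forall_mulVec_mem (h : ∀ v, T *ᵥ v ∈ LinearMap.range B.mulVecLin) :
    ∃ Q, T = B * Q := by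
  choose q hq using fun j => h (Pi.single j 1)
  refine ⟨Matrix.of fun i j => q j i, Matrix.ext_col fun j => ?_⟩
  rw [← Matrix.mulVec_single_one, ← hq]
  rfl

lemma exists_mkQ_mulVec_eq
    (f : ((Fin n → S) ⧸ LinearMap.range A.mulVecLin) →ₗ[S]
      (Fin n → S) ⧸ LinearMap.range B.mulVecLin) :
    ∃ P : Matrix (Fin n) (Fin n) S, ∀ v, f (Submodule.mkQ _ v) = Submodule.mkQ _ (P *ᵥ v) := by
  obtain ⟨g, hg⟩ := Module.projective_lifting_property
    (LinearMap.range B.mulVecLin).mkQ (f ∘ₗ (LinearMap.range A.mulVecLin).mkQ)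
    (Submodule.mkQ_surjective _)
  exact ⟨LinearMap.toMatrix' g, fun v => by
    rw [LinearMap.toMatrix'_mulVec]
    exact (LinearMap.congr_fun hg v).symm⟩

lemma exists_mul_eq_mul_of_coker_equiv
    (e : ((Fin n → S) ⧸ LinearMap.range A.mulVecLin) ≃ₗ[S]
      (Fin n → S) ⧸ LinearMap.range B.mulVecLin) :
    ∃ P P' Q Q' : Matrix (Fin n) (Fin n) S, P * A = B * Q ∧ P * P' - 1 = B * Q' := by
  obtain ⟨P, hP⟩ := exists_mkQ_mulVec_eq e.toLinearMap
  obtain ⟨P', hP'⟩ := exists_mkQ_mulVec_eq e.symm.toLinearMap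
  obtain ⟨Q, hQ⟩ : ∃ Q, P * A = B * Q := exists_eq_mul_of_forall_mulVec_mem fun v => by
    rw [← Submodule.Quotient.mk_eq_zero, ← Matrix.mulVec_mulVec]
    refine (hP _).symm.trans ?_
    have hAv : A *ᵥ v ∈ LinearMap.range A.mulVecLin := LinearMap.mem_range_self A.mulVecLin v
    rw [Submodule.mkQ_apply, (Submodule.Quotient.mk_eq_zero _).2 hAv, map_zero]
  obtain ⟨Q', hQ'⟩ : ∃ Q', P * P' - 1 = B * Q' := exists_eq_mul_of_forall_mulVec_mem fun v => by
    rw [Matrix.sub_mulVec, Matrix.one_mulVec, ← Submodule.Quotient.eq, ← Matrix.mulVec_mulVec]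
    refine (hP _).symm.trans ?_
    rw [← hP']
    exact e.apply_symm_apply _
  exact ⟨P, P', Q, Q', hQ, hQ'⟩

end CokerEquiv

section LinearParts

variable {k : Type u} [Field k] {n : ℕ}

lemma homogComp_eq_of_mk_eq {d : ℤ} (hd : d < 3) {s t : PolyRing k} (h : π s = π t) :
    homogComp d s = homogComp d t := by
  obtain ⟨q, hq⟩ := mk_eq_zero_iff.1 (show π (s - t) = 0 by rw [map_sub, h, sub_self])
  rw [← sub_eq_zero, ← map_sub, hq, mul_comm, homogComp_mul (cubic_mem_polyDeg k),
    homogComp_of_neg (by omega), LinearMap.zero_apply, zero_mul]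

lemma constantCoeff_eq_of_mk_eq {s t : PolyRing k} (h : π s = π t) :
    constantCoeff s = constantCoeff t := by
  have h0 := homogComp_eq_of_mk_eq (d := 0) (by norm_num) h
  rwa [homogComp_zero, homogComp_zero, C_inj] at h0

lemma homogComp_one_mul (s : PolyRing k) {t : PolyRing k} (ht : constantCoeff t = 0) :
    homogComp 1 (s * t) = C (constantCoeff s) * homogComp 1 t := by
  obtain ⟨c, rfl⟩ := Ideal.mem_span_range_iff_exists_fun.1 (mem_span_X_iff.2 ht)
  simp only [Finset.mul_sum, map_sum, ← mul_assoc, homogComp_mul (X_mem_polyDeg _), sub_self,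
    homogComp_zero, map_mul]

/-- The matrix of linear terms of the entries of `A`; up to equivalence over `k` it depends only
on `Coker A` when the entries of `A` have no constant terms. -/
def linearPart (A : Matrix (Fin n) (Fin n) (PolyRing k)) : Matrix (Fin n) (Fin n) (PolyRing k) :=
  A.map (homogComp 1)

variable {A B : Matrix (Fin n) (Fin n) (PolyRing k)}

lemma linearPart_mul_right (P : Matrix (Fin n) (Fin n) (PolyRing k))
    (hA : ∀ i j, constantCoeff (A i j) = 0) :
    linearPart (P * A) = (P.map constantCoeff).map C * linearPart A := by
  ext1 i j
  simp only [linearPart, Matrix.map_apply, Matrix.mul_apply, map_sum, homogComp_one_mul _ (hA _ _)]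

lemma linearPart_mul_left (Q : Matrix (Fin n) (Fin n) (PolyRing k))
    (hB : ∀ i j, constantCoeff (B i j) = 0) :
    linearPart (B * Q) = linearPart B * (Q.map constantCoeff).map C := by
  ext1 i j
  simp only [linearPart, Matrix.map_apply, Matrix.mul_apply, map_sum, mul_comm (B _ _),
    homogComp_one_mul _ (hB _ _), mul_comm (C _)]

lemma exists_linearPart_equiv (hA : ∀ i j, constantCoeff (A i j) = 0)
    (hB : ∀ i j, constantCoeff (B i j) = 0) (e : Coker A ≃ₗ[NodeRing k] Coker B) :
    ∃ P Q : Matrix (Fin n) (Fin n) k,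
      IsUnit P.det ∧ P.map C * linearPart A = linearPart B * Q.map C := by
  obtain ⟨P, P', Q, Q', hPQ, hPP'⟩ := exists_mul_eq_mul_of_coker_equiv e
  have hlift (T : Matrix (Fin n) (Fin n) (NodeRing k)) :
      ∃ T' : Matrix (Fin n) (Fin n) (PolyRing k), T'.map π = T := by
    choose T' hT' using fun i j => Ideal.Quotient.mk_surjective (T i j)
    exact ⟨Matrix.of T', Matrix.ext hT'⟩
  obtain ⟨P, rfl⟩ := hlift P
  obtain ⟨P', rfl⟩ := hlift P'
  obtain ⟨Q, rfl⟩ := hlift Q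
  obtain ⟨Q', rfl⟩ := hlift Q'
  refine ⟨P.map constantCoeff, Q.map constantCoeff, ?_, ?_⟩
  · simp only [← RingHom.mapMatrix_apply] at hPP'
    rw [← map_mul, ← map_one (RingHom.mapMatrix π), ← map_mul, ← map_sub] at hPP'
    have hzero : constantCoeff.mapMatrix (P * P' - 1) = 0 := Matrix.ext fun i j => by
      refine (constantCoeff_eq_of_mk_eq (congrFun (congrFun hPP' i) j)).trans ?_
      simp [Matrix.mul_apply, hB]
    rw [map_sub, map_one, map_mul, sub_eq_zero] at hzero
    exact Matrix.isUnit_det_of_right_inverse hzero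
  · rw [← linearPart_mul_right P hA, ← linearPart_mul_left Q hB]
    rw [← Matrix.map_mul, ← Matrix.map_mul] at hPQ
    exact Matrix.ext fun i j =>
      homogComp_eq_of_mk_eq (d := 1) (by norm_num) (congrFun (congrFun hPQ i) j)

lemma eval_linearPart_eq_zero (hA : ∀ i j, constantCoeff (A i j) = 0)
    (hB : ∀ i j, constantCoeff (B i j) = 0) (e : Coker A ≃ₗ[NodeRing k] Coker B) {x : Fin 3 → k}
    (hx : (linearPart B).map (eval x) = 0) : (linearPart A).map (eval x) = 0 := by
  obtain ⟨P, Q, hP, hPQ⟩ := exists_linearPart_equiv hA hB e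
  have heval : P * (linearPart A).map (eval x) = 0 := by
    simpa [Matrix.map_mul, Matrix.map_map, Function.comp_def, hx] using
      congrArg (fun T => T.map (eval x)) hPQ
  rw [← Matrix.one_mul ((linearPart A).map (eval x)), ← Matrix.nonsing_inv_mul P hP,
    Matrix.mul_assoc, heval, Matrix.mul_zero]

end LinearParts

section NonIsomorphic

variable {k : Type u} [Field k] {p q : ℙ k (Fin 3 → k)}

lemma linearPart_phi (hp : p ∈ curve k) :
    linearPart (phi p) = !![phi p 0 0, 0; phi p 1 0, 0] := by
  have h1 (i) : homogComp 1 (phi p i 0) = phi p i 0 := homogComp_self (phi_apply_mem_polyDeg hp i 0)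
  have h2 (i) : homogComp 1 (phi p i 1) = 0 :=
    homogComp_eq_zero (phi_apply_mem_polyDeg hp i 1) (by simp)
  ext1 i j
  fin_cases i <;> fin_cases j <;> simp [linearPart, h1, h2]

lemma linearPart_psi (hp : p ∈ curve k) :
    linearPart (psi p) = !![0, 0; -phi p 1 0, phi p 0 0] := by
  have h1 (i) : homogComp 1 (phi p i 0) = phi p i 0 := homogComp_self (phi_apply_mem_polyDeg hp i 0)
  have h2 (i) : homogComp 1 (phi p i 1) = 0 :=
    homogComp_eq_zero (phi_apply_mem_polyDeg hp i 1) (by simp)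
  ext1 i j
  fin_cases i <;> fin_cases j <;>
    simp [linearPart, psi_eq_adjugate, Matrix.adjugate_fin_two, h1, h2]

lemma constantCoeff_psi (hp : p ∈ curve k) (i j : Fin 2) : constantCoeff (psi p i j) = 0 := by
  fin_cases i <;> fin_cases j <;>
    simp [psi_eq_adjugate, Matrix.adjugate_fin_two, constantCoeff_phi hp]

theorem isEmpty_coker_phi_equiv_coker_phi (hp : p ∈ curve k) (hq : q ∈ curve k) (hpq : p ≠ q) :
    IsEmpty (Coker (phi p) ≃ₗ[NodeRing k] Coker (phi q)) := by
  refine ⟨fun e => hpq (eq_of_eval_rep_phi_col_zero hp fun i => ?_).symm⟩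
  have hzero := eval_linearPart_eq_zero (x := q.rep) (constantCoeff_phi hp) (constantCoeff_phi hq) e
    (by
      rw [linearPart_phi hq]
      ext1 i j
      fin_cases i <;> fin_cases j <;> simp [eval_rep_phi_col_zero hq])
  rw [linearPart_phi hp] at hzero
  have := congrFun (congrFun hzero i) 0
  fin_cases i <;> simpa using this

theorem isEmpty_coker_psi_equiv_coker_psi (hp : p ∈ curve k) (hq : q ∈ curve k) (hpq : p ≠ q) :
    IsEmpty (Coker (psi p) ≃ₗ[NodeRing k] Coker (psi q)) := by
  refine ⟨fun e => hpq (eq_of_eval_rep_phi_col_zero hp ?_).symm⟩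
  have hzero := eval_linearPart_eq_zero (x := q.rep) (constantCoeff_psi hp) (constantCoeff_psi hq) e
    (by
      rw [linearPart_psi hq]
      ext1 i j
      fin_cases i <;> fin_cases j <;> simp [eval_rep_phi_col_zero hq])
  rw [linearPart_psi hp] at hzero
  have h0 := congrFun (congrFun hzero 1) 1
  have h1 := congrFun (congrFun hzero 1) 0
  exact Fin.forall_fin_two.2 ⟨by simpa using h0, by simpa using h1⟩

theorem isEmpty_coker_phi_equiv_coker_psi (hp : p ∈ curve k) (hq : q ∈ curve k) :
    IsEmpty (Coker (phi p) ≃ₗ[NodeRing k] Coker (psi q)) := by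
  refine ⟨fun e => ?_⟩
  obtain ⟨P, Q, hP, hPQ⟩ := exists_linearPart_equiv (constantCoeff_phi hp) (constantCoeff_psi hq) e
  rw [linearPart_phi hp, linearPart_psi hq] at hPQ
  have hrow : ∑ i, C (P 0 i) * phi p i 0 = 0 := by
    simpa [Matrix.mul_apply] using congrFun (congrFun hPQ 0) 0
  have hP0 : P 0 = 0 :=
    eq_zero_of_sum_C_mul_col_eq_zero (det_phi hp ▸ cubic_irreducible k) (constantCoeff_phi hp) hrow
  exact hP.ne_zero (Matrix.det_eq_zero_of_row_eq_zero 0 (congrFun hP0))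

end NonIsomorphic

end SimpleNode

end

theorem mainTheorem5_general (k : Type*) [Field k] :
    (∀ p ∈ SimpleNode.curve k,
      SimpleNode.IsGradedMatrixFactorization (SimpleNode.cubic k) 3 ![1, 1] ![2, 3]
        (SimpleNode.phi p) (SimpleNode.psi p)) ∧
    (∀ (M : Type*) [AddCommGroup M] [Module (SimpleNode.NodeRing k) M]
      (gr : ℤ → AddSubgroup M),
      SimpleNode.IsGradedMCM (k := k) gr →
      (⊤ : Submodule (SimpleNode.NodeRing k) M).spanFinrank = 2 →
      ¬ Module.Free (SimpleNode.NodeRing k) M →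
      (∃ p ∈ SimpleNode.curveReg k, ∃ d : ℤ,
        SimpleNode.GradedIso k gr (SimpleNode.cokerPhiDeg p) d) ∨
      (∃ p ∈ SimpleNode.curveReg k, ∃ d : ℤ,
        SimpleNode.GradedIso k gr (SimpleNode.cokerPsiDeg p) d) ∨
      (∃ d : ℤ, SimpleNode.GradedIso k gr
        (SimpleNode.cokerPhiDeg (SimpleNode.singularPt k)) d) ∨
      (∃ d : ℤ, SimpleNode.GradedIso k gr
        (SimpleNode.cokerPsiDeg (SimpleNode.singularPt k)) d)) ∧
    (∀ p ∈ SimpleNode.curve k, ∀ q ∈ SimpleNode.curve k,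
      (p ≠ q → IsEmpty (SimpleNode.Coker (SimpleNode.phi p) ≃ₗ[SimpleNode.NodeRing k]
        SimpleNode.Coker (SimpleNode.phi q))) ∧
      (p ≠ q → IsEmpty (SimpleNode.Coker (SimpleNode.psi p) ≃ₗ[SimpleNode.NodeRing k]
        SimpleNode.Coker (SimpleNode.psi q))) ∧
      IsEmpty (SimpleNode.Coker (SimpleNode.phi p) ≃ₗ[SimpleNode.NodeRing k]
        SimpleNode.Coker (SimpleNode.psi q))) ∧
    (∀ p ∈ SimpleNode.curve k,
      Module.rank (SimpleNode.NodeRing k) (SimpleNode.Coker (SimpleNode.phi p)) = 1 ∧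
      Module.rank (SimpleNode.NodeRing k) (SimpleNode.Coker (SimpleNode.psi p)) = 1) ∧
    (∀ p ∈ SimpleNode.curve k,
      SimpleNode.IsFirstSyzygy k (SimpleNode.cokerPsiDeg p) (SimpleNode.cokerPhiDeg p) 2 ∧
      SimpleNode.GradedIso k (SimpleNode.cokerPsiDeg p)
        (SimpleNode.dualDeg k (SimpleNode.cokerPhiDeg p)) 0) := by
  open SimpleNode in
  refine ⟨fun p hp => isGradedMatrixFactorization hp, fun M _ _ gr hM h2 hfree => ?_,
    fun p hp q hq => ⟨isEmpty_coker_phi_equiv_coker_phi hp hq,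
      isEmpty_coker_psi_equiv_coker_psi hp hq, isEmpty_coker_phi_equiv_coker_psi hp hq⟩,
    fun p hp => rank_coker_phi_psi hp,
    fun p hp => ⟨isFirstSyzygy_coker_psi hp, gradedIso_coker_psi_dual hp⟩⟩
  obtain ⟨p, hp, d, hd⟩ := hM.exists_gradedIso_coker h2 hfree
  by_cases hs : p = SimpleNode.singularPt k
  · subst hs
    exact Or.inr (Or.inr (hd.imp (⟨d, ·⟩) (⟨d, ·⟩)))
  · exact hd.elim (fun hphi => Or.inl ⟨p, ⟨hp, hs⟩, d, hphi⟩)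
      fun hpsi => Or.inr (Or.inl ⟨p, ⟨hp, hs⟩, d, hpsi⟩)

theorem mainTheorem5 (k : Type*) [Field k] :
    -- (1) `(φ_p, ψ_p)` is a graded matrix factorization of `f` for every `p ∈ V(f)`
    (∀ p ∈ SimpleNode.curve k,
      SimpleNode.IsGradedMatrixFactorization (SimpleNode.cubic k) 3 ![1, 1] ![2, 3]
        (SimpleNode.phi p) (SimpleNode.psi p)) ∧
    -- (2) two-generated non-free graded MCM modules are on the list, up to shift
    (∀ (M : Type*) [AddCommGroup M] [Module (SimpleNode.NodeRing k) M]
      (gr : ℤ → AddSubgroup M),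
      SimpleNode.IsGradedMCM (k := k) gr →
      (⊤ : Submodule (SimpleNode.NodeRing k) M).spanFinrank = 2 →
      ¬ Module.Free (SimpleNode.NodeRing k) M →
      (∃ p ∈ SimpleNode.curveReg k, ∃ d : ℤ,
        SimpleNode.GradedIso k gr (SimpleNode.cokerPhiDeg p) d) ∨
      (∃ p ∈ SimpleNode.curveReg k, ∃ d : ℤ,
        SimpleNode.GradedIso k gr (SimpleNode.cokerPsiDeg p) d) ∨
      (∃ d : ℤ, SimpleNode.GradedIso k gr
        (SimpleNode.cokerPhiDeg (SimpleNode.singularPt k)) d) ∨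
      (∃ d : ℤ, SimpleNode.GradedIso k gr
        (SimpleNode.cokerPsiDeg (SimpleNode.singularPt k)) d)) ∧
    -- (3) the modules on the list are pairwise non-isomorphic, even as ungraded modules
    (∀ p ∈ SimpleNode.curve k, ∀ q ∈ SimpleNode.curve k,
      (p ≠ q → IsEmpty (SimpleNode.Coker (SimpleNode.phi p) ≃ₗ[SimpleNode.NodeRing k]
        SimpleNode.Coker (SimpleNode.phi q))) ∧
      (p ≠ q → IsEmpty (SimpleNode.Coker (SimpleNode.psi p) ≃ₗ[SimpleNode.NodeRing k]
        SimpleNode.Coker (SimpleNode.psi q))) ∧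
      IsEmpty (SimpleNode.Coker (SimpleNode.phi p) ≃ₗ[SimpleNode.NodeRing k]
        SimpleNode.Coker (SimpleNode.psi q))) ∧
    -- (4) all modules on the list have rank one
    (∀ p ∈ SimpleNode.curve k,
      Module.rank (SimpleNode.NodeRing k) (SimpleNode.Coker (SimpleNode.phi p)) = 1 ∧
      Module.rank (SimpleNode.NodeRing k) (SimpleNode.Coker (SimpleNode.psi p)) = 1) ∧
    -- (5) `Coker ψ_p`, shifted by two, is the first syzygy, and `Coker ψ_p` is the dual,
    -- of `Coker φ_p`
    (∀ p ∈ SimpleNode.curveReg k,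
      SimpleNode.IsFirstSyzygy k (SimpleNode.cokerPsiDeg p) (SimpleNode.cokerPhiDeg p) 2 ∧
      SimpleNode.GradedIso k (SimpleNode.cokerPsiDeg p)
        (SimpleNode.dualDeg k (SimpleNode.cokerPhiDeg p)) 0) := by
  obtain ⟨hfact, hclass, hiso, hrank, hdual⟩ := mainTheorem5_general k
  exact ⟨hfact, hclass, hiso, hrank, fun p hp => hdual p hp.1⟩
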